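/- **Theorem 1.** For a finite simplicial complex $X$ let $H_{d-1}(X)_T$ denote the torsion subgroup of its integral simplicial homology group $H_{d-1}(X;\mathbb{Z})$. For an integer $d \ge 2$ and a finite abelian group $G$, let $T_d(G)$ be the minimum number $n$ such that there is a simplicial complex $X$ with exactly $n$ vertices and $H_{d-1}(X)_T \cong G$ (the empty complex, with $n = 0$, is allowed; thus $T_d(G) = 0$ for the trivial group $G$). Then for every $d \ge 2$ there are real constants $c_d > 0$ and $C_d > 0$, depending only on $d$, such that for every finite abelian group $G$ such a complex exists and $$c_d\,(\log |G|)^{1/d} \;\le\; T_d(G) \;\le\; C_d\,(\log |G|)^{1/d},$$ where $\log$ is the natural logarithm. -/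

import Mathlib

noncomputable section

namespace AbstractSimplicialComplex

variable {V : Type*} [LinearOrder V]

/-- The `k`-dimensional faces of `K`, i.e. the faces with `k + 1` vertices. -/
def Simplex (K : AbstractSimplicialComplex V) (k : ℕ) : Type _ :=
  {s : Finset V // s ∈ K.faces ∧ s.card = k + 1}

/-- The integral simplicial `k`-chains of `K`. Each face is oriented by the order of its vertices. -/
abbrev Chain (K : AbstractSimplicialComplex V) (k : ℕ) : Type _ :=
  K.Simplex k →₀ ℤ

/-- The `k`-dimensional face of a `(k + 1)`-dimensional face `s` opposite to the vertex `v`. -/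
def Simplex.facet {K : AbstractSimplicialComplex V} {k : ℕ} (s : K.Simplex (k + 1))
    (v : {v // v ∈ s.1}) : K.Simplex k :=
  ⟨s.1.erase v.1, by
    have hc : (s.1.erase v.1).card = k + 1 := by
      rw [Finset.card_erase_of_mem v.2, s.2.2]; rfl
    exact ⟨(K.isRelLowerSet_faces s.2.1).2 (Finset.erase_subset _ _)
      (Finset.card_pos.mp (by rw [hc]; exact Nat.succ_pos k)), hc⟩⟩

/-- The sign `(-1) ^ i`, where `v` is the `i`-th vertex of `s` in increasing order, counted
from zero. -/
def vertexSign (s : Finset V) (v : V) : ℤ :=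
  (-1) ^ (s.filter (fun w => w < v)).card

/-- The simplicial boundary operator from `(k + 1)`-chains to `k`-chains, which sends
`[v₀, …, vₖ₊₁]` with `v₀ < ⋯ < vₖ₊₁` to the alternating sum over `i` of the faces with the
vertex `vᵢ` removed. -/
def boundary (K : AbstractSimplicialComplex V) (k : ℕ) : K.Chain (k + 1) →ₗ[ℤ] K.Chain k :=
  Finsupp.linearCombination ℤ fun s : K.Simplex (k + 1) =>
    ∑ v : {v // v ∈ s.1}, Finsupp.single (s.facet v) (vertexSign s.1 v.1)

theorem vertexSign_mul_erase {s : Finset V} {v w : V} (hv : v ∈ s) (hw : w ∈ s) (h : v ≠ w) :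
    vertexSign s v * vertexSign (s.erase v) w
      + vertexSign s w * vertexSign (s.erase w) v = 0 := by
  wlog hlt : v < w generalizing v w
  · rw [add_comm]
    exact this hw hv h.symm (lt_of_le_of_ne (not_lt.mp hlt) h.symm)
  have h1 : vertexSign (s.erase w) v = vertexSign s v := by
    unfold vertexSign
    congr 2
    ext x
    simp only [Finset.mem_filter, Finset.mem_erase]
    constructor
    · rintro ⟨⟨_, hx⟩, hxv⟩
      exact ⟨hx, hxv⟩
    · rintro ⟨hx, hxv⟩
      exact ⟨⟨(hxv.trans hlt).ne, hx⟩, hxv⟩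
  have h2 : vertexSign s w = - vertexSign (s.erase v) w := by
    unfold vertexSign
    rw [Finset.filter_erase, ← Finset.card_erase_add_one
      (show v ∈ s.filter (fun x => x < w) from Finset.mem_filter.mpr ⟨hv, hlt⟩), pow_succ]
    ring
  rw [h1, h2]
  ring

/-- The composite of two consecutive boundary operators vanishes. -/
theorem boundary_boundary (K : AbstractSimplicialComplex V) (k : ℕ) :
    (K.boundary k) ∘ₗ (K.boundary (k + 1)) = 0 := by
  refine Finsupp.lhom_ext' fun s => LinearMap.ext_ring ?_
  simp only [LinearMap.comp_apply, Finsupp.lsingle_apply, LinearMap.zero_apply, boundary,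
    Finsupp.linearCombination_single, one_smul, map_sum, Finset.smul_sum, Finsupp.smul_single,
    smul_eq_mul]
  rw [Finset.sum_sigma']
  refine Finset.sum_involution
    (fun p _ => ⟨⟨p.2.1, Finset.mem_of_mem_erase p.2.2⟩, ⟨p.1.1, Finset.mem_erase.mpr
      ⟨(Finset.ne_of_mem_erase p.2.2).symm, p.1.2⟩⟩⟩) ?_ ?_ ?_ ?_
  · rintro ⟨⟨v, hv⟩, ⟨w, hw⟩⟩ -
    have hw' := Finset.mem_erase.mp hw
    have e : (s.facet ⟨w, hw'.2⟩).facet ⟨v, Finset.mem_erase.mpr ⟨hw'.1.symm, hv⟩⟩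
        = (s.facet ⟨v, hv⟩).facet ⟨w, hw⟩ :=
      Subtype.ext (Finset.erase_right_comm)
    dsimp only
    rw [e, ← Finsupp.single_add]
    exact (congrArg _ (vertexSign_mul_erase hv hw'.2 hw'.1.symm)).trans (Finsupp.single_zero _)
  · rintro ⟨⟨v, hv⟩, ⟨w, hw⟩⟩ - - h
    have h' := congrArg (fun p => p.1.1) h
    exact (Finset.ne_of_mem_erase hw) h'
  · intro p _
    exact Finset.mem_univ _
  · rintro ⟨⟨v, hv⟩, ⟨w, hw⟩⟩ -
    rfl

/-- The simplicial `k`-cycles of `K`; every `0`-chain is a cycle (homology is not reduced). -/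
def cycles (K : AbstractSimplicialComplex V) : (k : ℕ) → Submodule ℤ (K.Chain k)
  | 0 => ⊤
  | k + 1 => LinearMap.ker (K.boundary k)

/-- The `k`-th simplicial homology group `H_k(K; ℤ)`: cycles modulo boundaries. -/
abbrev Homology (K : AbstractSimplicialComplex V) (k : ℕ) : Type _ :=
  K.cycles k ⧸ (LinearMap.range (K.boundary k)).submoduleOf (K.cycles k)

end AbstractSimplicialComplex

/-- The numbers `n` for which there is a simplicial complex `X` with exactly `n` vertices (all
elements of `Fin n` are vertices of `X`) such that the torsion subgroup of `H_{d-1}(X; ℤ)` is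
isomorphic to `G`. For `n = 0` the complex is empty. -/
def torsionVertexCounts (d : ℕ) (G : Type*) [AddCommGroup G] : Set ℕ :=
  {n | ∃ X : AbstractSimplicialComplex (Fin n),
    Nonempty (AddCommGroup.torsion (X.Homology (d - 1)) ≃+ G)}

/-- `T_d(G)`: the least number of vertices of a simplicial complex whose `(d-1)`-st integral
homology group has torsion subgroup isomorphic to `G`. -/
def torsionVertexNumber (d : ℕ) (G : Type*) [AddCommGroup G] : ℕ :=
  sInf (torsionVertexCounts d G)

end

/-! ### Greedy colorings that separate faces with `d` vertices. -/

section Coloring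

open Finset

variable {V : Type*}

/-! Write `d = k + 2`.

Lower bound. A chain representing a torsion class of `H_{d-1}` is a rational combination of
independent boundaries of `d`-simplices. Passing to fractional parts of the coefficients changes it
by an integral boundary and bounds its `ℓ¹` norm by `d + 1` times the number of `(d-1)`-faces. The
number of such short chains is exponential in the number of `(d-1)`-faces, which is at most `n ^ d`;
hence `log |G| = O(n ^ d)` (`card_torsion_homology_le`).

Upper bound. By repeated doubling, `G` is the torsion of a group with `O(log |G|)` generators and
three-term relations `a - b + c = 0`, each generator being used boundedly often
(`exists_presentation`). The presentation is realized geometrically: a generator is the boundary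
sphere of a missing `d`-simplex, a relation is the boundary of a `(d+1)`-simplex with three facets
missing, and cylinders join these three holes to the spheres of the generators. This takes `O(log
|G|)` vertices, each in boundedly many faces. Finally vertices are identified along a coloring with
`O((log |G|)^{1/d})` colors under which distinct faces with `d` vertices keep distinct color sets
(`exists_coloring`).

The colored complex is not compared with the uncolored one. The axioms of `SimplexSystem` concern
incidences of sets with `d` vertices, which survive the coloring, and they make the boundary matrix
unitriangular on suitable rows. This determines the torsion (`nonempty_torsion_homology_addEquiv`).
-/

/-- The faces contained in `W` whose vertices carry exactly the colors in `S`. -/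
def coloredFaces {κ : Type*} [DecidableEq V] [DecidableEq κ] (𝓕 : Finset (Finset V)) (col : V → κ)
    (W : Finset V) (S : Finset κ) : Finset (Finset V) :=
  {F ∈ 𝓕 | F ⊆ W ∧ F.image col = S}

/-- Two vertices that are both adjacent to a common vertex. -/
def Conflict (𝓕 : Finset (Finset V)) (v w : V) : Prop :=
  ∃ u, ∃ F ∈ 𝓕, ∃ F' ∈ 𝓕, v ∈ F ∧ u ∈ F ∧ u ∈ F' ∧ w ∈ F'

theorem Conflict.symm {𝓕 : Finset (Finset V)} {v w : V} (h : Conflict 𝓕 v w) :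
    Conflict 𝓕 w v := by
  obtain ⟨u, F, hF, F', hF', h1, h2, h3, h4⟩ := h
  exact ⟨u, F', hF', F, hF, h4, h3, h2, h1⟩

variable [DecidableEq V]

theorem card_conflict_le {𝓕 : Finset (Finset V)} {Δ m : ℕ}
    (hdeg : ∀ v, #{F ∈ 𝓕 | v ∈ F} ≤ Δ) (hm : ∀ F ∈ 𝓕, #F ≤ m) (v : V) :
    ∃ s : Finset V, (∀ w, Conflict 𝓕 v w → w ∈ s) ∧ #s ≤ Δ * (m * (Δ * m)) := by
  refine ⟨({F ∈ 𝓕 | v ∈ F}).biUnion fun F => F.biUnion fun u =>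
    ({F' ∈ 𝓕 | u ∈ F'}).biUnion fun F' => F', ?_, ?_⟩
  · rintro w ⟨u, F, hF, F', hF', h1, h2, h3, h4⟩
    simp only [mem_biUnion, mem_filter]
    exact ⟨F, ⟨hF, h1⟩, u, h2, F', ⟨hF', h3⟩, h4⟩
  · refine (card_biUnion_le_card_mul _ _ (m * (Δ * m)) fun F hF => ?_).trans
      (Nat.mul_le_mul_right _ (hdeg v))
    refine (card_biUnion_le_card_mul _ _ (Δ * m) fun u _ => ?_).trans
      (Nat.mul_le_mul_right _ (hm F (mem_filter.mp hF).1))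
    exact (card_biUnion_le_card_mul _ _ m fun F' hF' => hm F' (mem_filter.mp hF').1).trans
      (Nat.mul_le_mul_right _ (hdeg u))

/-- Few colors extend the pattern `S` to a pattern that occurs often. -/
theorem card_saturated_le {κ : Type*} [DecidableEq κ] [Fintype κ] {𝓕 : Finset (Finset V)}
    {Δ q d : ℕ} [Fintype V] (hdown : ∀ F ∈ 𝓕, ∀ F' ⊆ F, F' ∈ 𝓕)
    (hdeg : ∀ v, #{F ∈ 𝓕 | v ∈ F} ≤ Δ) (hΔ : 1 ≤ Δ) (hq : 1 ≤ q)
    (hV : Fintype.card V ≤ q ^ d) {col : V → κ} {W : Finset V}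
    (hcol : ∀ v ∈ W, ∀ w ∈ W, v ≠ w → Conflict 𝓕 v w → col v ≠ col w) {S : Finset κ}
    (hS : #S < d) (hN : #(coloredFaces 𝓕 col W S) ≤ q ^ (d - #S)) :
    #{k : κ | k ∉ S ∧ q ^ (d - #S - 1) ≤ #(coloredFaces 𝓕 col W (insert k S))} ≤ Δ * q := by
  set P : Finset κ := {k : κ | k ∉ S ∧ q ^ (d - #S - 1) ≤ #(coloredFaces 𝓕 col W (insert k S))}
    with hP
  have hinj : ∀ F ∈ 𝓕, F ⊆ W → ∀ v ∈ F, ∀ w ∈ F, col v = col w → v = w := by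
    intro F hF hFW v hv w hw h
    by_contra hne
    exact hcol v (hFW hv) w (hFW hw) hne ⟨v, F, hF, F, hF, hv, hv, hv, hw⟩ h
  -- Deleting the vertex of the new color maps these faces to faces of pattern `S`; its fibers have
  -- size at most `Δ`, since the image contains a vertex of color `s`. For the empty pattern the
  -- faces are single vertices, of which there are at most `q ^ d`.
  have key : #(P.biUnion fun k => coloredFaces 𝓕 col W (insert k S)) ≤ Δ * q ^ (d - #S) := by
    rcases S.eq_empty_or_nonempty with rfl | ⟨s, hs⟩
    · have : (P.biUnion fun k => coloredFaces 𝓕 col W (insert k ∅)) ⊆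
          (univ : Finset V).image fun v => {v} := by
        intro F hF
        simp only [mem_biUnion, coloredFaces, mem_filter] at hF
        obtain ⟨k, -, hF, hFW, hk⟩ := hF
        have hc : #F = 1 := by
          rw [← card_image_of_injOn (f := col) (fun v hv w hw => hinj F hF hFW v hv w hw), hk]
          simp
        obtain ⟨v, rfl⟩ := card_eq_one.mp hc
        simp
      refine (card_le_card this).trans (card_image_le.trans ?_)
      simp only [card_empty, Nat.sub_zero, card_univ]
      nlinarith
    · refine le_trans (card_le_mul_card_image_of_maps_to
        (f := fun F => F.filter fun v => col v ∈ S) (t := coloredFaces 𝓕 col W S) ?_ Δ ?_)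
        (Nat.mul_le_mul_left _ hN)
      · intro F hF
        simp only [mem_biUnion, coloredFaces, mem_filter] at hF ⊢
        obtain ⟨k, hk, hF, hFW, hk'⟩ := hF
        refine ⟨hdown F hF _ (filter_subset _ _), (filter_subset _ _).trans hFW, ?_⟩
        ext c
        simp only [mem_image, mem_filter]
        constructor
        · rintro ⟨v, ⟨-, h⟩, rfl⟩
          exact h
        · intro hc
          have : c ∈ F.image col := by rw [hk']; exact mem_insert_of_mem hc
          obtain ⟨v, hv, rfl⟩ := mem_image.mp this
          exact ⟨v, ⟨hv, hc⟩, rfl⟩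
      · intro F' hF'
        simp only [coloredFaces, mem_filter] at hF'
        have : s ∈ F'.image col := by rw [hF'.2.2]; exact hs
        obtain ⟨v, hv, -⟩ := mem_image.mp this
        refine (card_le_card ?_).trans (hdeg v)
        intro F hF
        simp only [mem_filter, mem_biUnion, coloredFaces] at hF ⊢
        obtain ⟨⟨k, -, hF, -⟩, rfl⟩ := hF
        exact ⟨hF, (mem_filter.mp hv).1⟩
  rw [card_biUnion] at key
  · have h2 : #P * q ^ (d - #S - 1) ≤
        ∑ k ∈ P, #(coloredFaces 𝓕 col W (insert k S)) := by
      rw [← smul_eq_mul]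
      exact card_nsmul_le_sum _ _ _ fun k hk => (mem_filter.mp hk).2.2
    have h3 : q ^ (d - #S) = q * q ^ (d - #S - 1) := by
      rw [← pow_succ']; congr 1; omega
    rw [h3] at key
    have hpos : 0 < q ^ (d - #S - 1) := Nat.pow_pos hq
    refine Nat.le_of_mul_le_mul_right (?_ : _ * q ^ (d - #S - 1) ≤ _) hpos
    calc _ ≤ _ := h2
      _ ≤ _ := key
      _ = _ := by ring
  · intro k hk l hl hkl
    rw [Function.onFun, disjoint_left]
    intro F hF hF'
    simp only [coloredFaces, mem_filter] at hF hF'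
    have h := hF.2.2.symm.trans hF'.2.2
    have : k ∈ insert l S := h ▸ mem_insert_self k S
    rcases mem_insert.mp this with h | h
    · exact hkl h
    · exact (mem_filter.mp hk).2.1 h

/-- One step of the greedy coloring. -/
theorem exists_extend_coloring [Fintype V] {𝓕 : Finset (Finset V)} {Δ q d m K : ℕ}
    (hdown : ∀ F ∈ 𝓕, ∀ F' ⊆ F, F' ∈ 𝓕)
    (hdeg : ∀ v, #{F ∈ 𝓕 | v ∈ F} ≤ Δ) (hm : ∀ F ∈ 𝓕, #F ≤ m) (hΔ : 1 ≤ Δ) (hq : 1 ≤ q)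
    (hV : Fintype.card V ≤ q ^ d) (hK : Δ * (m * (Δ * m)) + Δ * (Δ * q) < K)
    {col : V → Fin K} {W : Finset V} {v : V} (hv : v ∉ W)
    (hcol : ∀ v ∈ W, ∀ w ∈ W, v ≠ w → Conflict 𝓕 v w → col v ≠ col w)
    (hN : ∀ S : Finset (Fin K), #S ≤ d → #(coloredFaces 𝓕 col W S) ≤ q ^ (d - #S)) :
    ∃ col' : V → Fin K,
      (∀ v' ∈ insert v W, ∀ w ∈ insert v W, v' ≠ w → Conflict 𝓕 v' w → col' v' ≠ col' w) ∧
      ∀ S : Finset (Fin K), #S ≤ d → #(coloredFaces 𝓕 col' (insert v W) S) ≤ q ^ (d - #S) := by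
  obtain ⟨s, hs, hsc⟩ := card_conflict_le hdeg hm v
  set sat : Finset (Fin K) → Finset (Fin K) := fun S =>
    {k | k ∉ S ∧ q ^ (d - #S - 1) ≤ #(coloredFaces 𝓕 col W (insert k S))} with hsat
  -- Forbidden are the colors of conflicting vertices and, for each face through `v`, the colors
  -- completing its pattern to one that is already at capacity.
  set bad : Finset (Fin K) := s.image col ∪
    ({F ∈ 𝓕 | v ∈ F}).biUnion fun F =>
      if #((F.erase v).image col) < d then sat ((F.erase v).image col) else ∅ with hbad
  have hbc : #bad < K := by
    refine lt_of_le_of_lt ?_ hK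
    refine (card_union_le _ _).trans (Nat.add_le_add (card_image_le.trans hsc) ?_)
    refine (card_biUnion_le_card_mul _ _ (Δ * q) fun F hF => ?_).trans
      (Nat.mul_le_mul_right _ (hdeg v))
    split_ifs with h
    · exact card_saturated_le hdown hdeg hΔ hq hV hcol h (hN _ h.le)
    · simp
  obtain ⟨k, hk⟩ : ∃ k, k ∉ bad := by
    by_contra! h
    have : bad = univ := eq_univ_iff_forall.mpr h
    rw [this, card_univ, Fintype.card_fin] at hbc
    exact lt_irrefl _ hbc
  have hks : ∀ w, Conflict 𝓕 v w → col w ≠ k := by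
    rintro w hw rfl
    exact hk (mem_union_left _ (mem_image_of_mem _ (hs w hw)))
  have hW : ∀ w ∈ W, Function.update col v k w = col w := fun w hw =>
    Function.update_of_ne (by rintro rfl; exact hv hw) _ _
  have hWi : ∀ F ⊆ W, F.image (Function.update col v k) = F.image col := fun F hF =>
    image_congr fun w hw => hW w (hF hw)
  refine ⟨Function.update col v k, ?_, ?_⟩
  · intro a ha b hb hab hc
    rcases mem_insert.mp ha with hav | haW
    · subst hav
      rcases mem_insert.mp hb with hbv | hbW
      · exact absurd hbv.symm hab
      · rw [hW b hbW, Function.update_self]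
        exact (hks b hc).symm
    · rcases mem_insert.mp hb with hbv | hbW
      · subst hbv
        rw [hW a haW, Function.update_self]
        exact hks a hc.symm
      · rw [hW a haW, hW b hbW]
        exact hcol a haW b hbW hab hc
  · intro S hS
    have hsub : coloredFaces 𝓕 (Function.update col v k) (insert v W) S ⊆
        coloredFaces 𝓕 col W S ∪
          {F ∈ coloredFaces 𝓕 (Function.update col v k) (insert v W) S | v ∈ F} := by
      intro F hF
      by_cases hvF : v ∈ F
      · exact mem_union_right _ (mem_filter.mpr ⟨hF, hvF⟩)
      · refine mem_union_left _ ?_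
        simp only [coloredFaces, mem_filter] at hF ⊢
        have hFW : F ⊆ W := (subset_insert_iff_of_notMem hvF).mp hF.2.1
        exact ⟨hF.1, hFW, by rw [← hWi F hFW]; exact hF.2.2⟩
    rcases ({F ∈ coloredFaces 𝓕 (Function.update col v k) (insert v W) S | v ∈ F}).eq_empty_or_nonempty
      with he | ⟨F₀, hF₀⟩
    · rw [he, union_empty] at hsub
      exact (card_le_card hsub).trans (hN S hS)
    · have hdesc : ∀ F ∈ coloredFaces 𝓕 (Function.update col v k) (insert v W) S, v ∈ F →
          F ∈ 𝓕 ∧ F.erase v ⊆ W ∧ k ∉ (F.erase v).image col ∧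
            S = insert k ((F.erase v).image col) := by
        intro F hF hvF
        simp only [coloredFaces, mem_filter] at hF
        have hFW : F.erase v ⊆ W := subset_insert_iff.mp hF.2.1
        refine ⟨hF.1, hFW, ?_, ?_⟩
        · intro h
          obtain ⟨w, hw, hwk⟩ := mem_image.mp h
          exact hks w ⟨v, F, hF.1, F, hF.1, hvF, hvF, hvF, mem_of_mem_erase hw⟩ hwk
        · rw [← hF.2.2, ← hWi _ hFW]
          conv_lhs => rw [← insert_erase hvF, image_insert, Function.update_self]
      rw [mem_filter] at hF₀
      obtain ⟨hF, hFW, hkF, hSF⟩ := hdesc F₀ hF₀.1 hF₀.2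
      -- Vertices adjacent to `v` pairwise conflict, so a face through `v` is determined by its
      -- colors. Hence `v` adds at most one face to each pattern, and the choice of `k` leaves room
      -- for it.
      have huniq : {F ∈ coloredFaces 𝓕 (Function.update col v k) (insert v W) S | v ∈ F} ⊆ {F₀} := by
        intro F hF'
        rw [mem_filter] at hF'
        obtain ⟨gF, gFW, gkF, gSF⟩ := hdesc F hF'.1 hF'.2
        have himg : (F.erase v).image col = (F₀.erase v).image col := by
          rw [← erase_insert gkF, ← gSF, hSF, erase_insert hkF]
        have hsub2 : ∀ A ∈ 𝓕, ∀ B ∈ 𝓕, v ∈ A → v ∈ B → A.erase v ⊆ W → B.erase v ⊆ W →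
            (A.erase v).image col = (B.erase v).image col → A.erase v ⊆ B.erase v := by
          intro A hA B hB hvA hvB hAW hBW h w hw
          have : col w ∈ (B.erase v).image col := h ▸ mem_image_of_mem col hw
          obtain ⟨w', hw', hww⟩ := mem_image.mp this
          by_contra hne
          refine hcol w (hAW hw) w' (hBW hw') (fun e => hne (e ▸ hw')) ?_ hww.symm
          exact ⟨v, A, hA, B, hB, mem_of_mem_erase hw, hvA, hvB, mem_of_mem_erase hw'⟩
        rw [mem_singleton, ← insert_erase hF'.2, ← insert_erase hF₀.2]
        congr 1
        exact (hsub2 F gF F₀ hF hF'.2 hF₀.2 gFW hFW himg).antisymm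
          (hsub2 F₀ hF F gF hF₀.2 hF'.2 hFW gFW himg.symm)
      have hcard : #S = #((F₀.erase v).image col) + 1 := by rw [hSF, card_insert_of_notMem hkF]
      have hlt : #(coloredFaces 𝓕 col W S) < q ^ (d - #S) := by
        by_contra! hge
        refine hk (mem_union_right _ (mem_biUnion.mpr ⟨F₀, mem_filter.mpr ⟨hF, hF₀.2⟩, ?_⟩))
        rw [if_pos (by omega)]
        refine mem_filter.mpr ⟨mem_univ _, hkF, ?_⟩
        rw [← hSF, show d - #((F₀.erase v).image col) - 1 = d - #S by omega]
        exact hge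
      have h1 := card_le_card huniq
      rw [card_singleton] at h1
      have h2 := (card_le_card hsub).trans (card_union_le _ _)
      omega

/-- A family of faces of bounded degree on at most `q ^ d` vertices has a coloring with `O(q)`
colors for which distinct faces with `d` vertices get distinct sets of `d` colors. -/
theorem exists_coloring [Fintype V] {𝓕 : Finset (Finset V)} {Δ q d m K : ℕ}
    (hdown : ∀ F ∈ 𝓕, ∀ F' ⊆ F, F' ∈ 𝓕)
    (hdeg : ∀ v, #{F ∈ 𝓕 | v ∈ F} ≤ Δ) (hm : ∀ F ∈ 𝓕, #F ≤ m) (hΔ : 1 ≤ Δ) (hq : 1 ≤ q)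
    (hV : Fintype.card V ≤ q ^ d) (hK : Δ * (m * (Δ * m)) + Δ * (Δ * q) < K) :
    ∃ col : V → Fin K, (∀ F ∈ 𝓕, Set.InjOn col F) ∧
      ∀ F ∈ 𝓕, ∀ F' ∈ 𝓕, #F = d → F.image col = F'.image col → F = F' := by
  -- For `#S = d` the bound is `q ^ 0 = 1`, which is the required separation; the bounds for smaller
  -- patterns serve to keep few colors saturated.
  have main : ∀ W : Finset V, ∃ col : V → Fin K,
      (∀ v' ∈ W, ∀ w ∈ W, v' ≠ w → Conflict 𝓕 v' w → col v' ≠ col w) ∧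
      ∀ S : Finset (Fin K), #S ≤ d → #(coloredFaces 𝓕 col W S) ≤ q ^ (d - #S) := by
    intro W
    induction W using Finset.induction_on with
    | empty =>
      refine ⟨fun _ => ⟨0, by omega⟩, by simp, fun S _ => ?_⟩
      refine le_trans (card_le_card (t := {∅}) ?_) (by simpa using Nat.one_le_pow _ _ hq)
      intro F hF
      simp only [coloredFaces, mem_filter, subset_empty] at hF
      simp [hF.2.1]
    | insert v W hv ih =>
      obtain ⟨col, hcol, hN⟩ := ih
      exact exists_extend_coloring hdown hdeg hm hΔ hq hV hK hv hcol hN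
  obtain ⟨col, hcol, hN⟩ := main univ
  have hinj : ∀ F ∈ 𝓕, Set.InjOn col F := by
    intro F hF v hv w hw h
    by_contra hne
    exact hcol v (mem_univ _) w (mem_univ _) hne ⟨v, F, hF, F, hF, hv, hv, hv, hw⟩ h
  refine ⟨col, hinj, ?_⟩
  intro F hF F' hF' hc h
  have hcS : #(F.image col) = d := by rw [card_image_of_injOn (hinj F hF), hc]
  have := hN (F.image col) hcS.le
  rw [hcS, Nat.sub_self, pow_zero] at this
  refine card_le_one.mp this F ?_ F' ?_
  · simp [coloredFaces, hF]
  · simp [coloredFaces, hF', h]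

end Coloring

/-! ### Simplex systems and their unitriangular boundary matrix. -/

noncomputable section

open Finset

namespace AbstractSimplicialComplex

variable {V : Type*} [LinearOrder V]

theorem vertexSign_mul_self (s : Finset V) (v : V) : vertexSign s v * vertexSign s v = 1 := by
  rw [vertexSign, ← pow_add, ← two_mul, pow_mul]; simp

theorem vertexSign_isUnit (s : Finset V) (v : V) : IsUnit (vertexSign s v) :=
  IsUnit.of_mul_eq_one _ (vertexSign_mul_self s v)

/-- The simplicial boundary on the free abelian group of all finite sets of vertices. -/
def finsetBoundary (V : Type*) [LinearOrder V] : (Finset V →₀ ℤ) →ₗ[ℤ] (Finset V →₀ ℤ) :=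
  Finsupp.linearCombination ℤ fun s => ∑ v ∈ s, Finsupp.single (s.erase v) (vertexSign s v)

theorem finsetBoundary_single (s : Finset V) (a : ℤ) :
    finsetBoundary V (Finsupp.single s a) =
      a • ∑ v ∈ s, Finsupp.single (s.erase v) (vertexSign s v) := by
  rw [finsetBoundary, Finsupp.linearCombination_single]

/-- Stated for all finite sets because it is applied to simplices and virtual facets that need not
be faces of a complex. -/
theorem finsetBoundary_finsetBoundary (x : Finset V →₀ ℤ) :
    finsetBoundary V (finsetBoundary V x) = 0 := by
  suffices h : finsetBoundary V ∘ₗ finsetBoundary V = 0 from LinearMap.congr_fun h x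
  refine Finsupp.lhom_ext' fun s => LinearMap.ext_ring ?_
  simp only [LinearMap.comp_apply, Finsupp.lsingle_apply, LinearMap.zero_apply,
    finsetBoundary_single, one_smul, map_sum, Finset.smul_sum, Finsupp.smul_single, smul_eq_mul]
  rw [Finset.sum_sigma']
  refine Finset.sum_involution (fun p _ => ⟨p.2, p.1⟩) ?_ ?_ ?_ ?_
  · rintro ⟨v, w⟩ h
    simp only [mem_sigma, mem_erase] at h
    dsimp only
    rw [Finset.erase_right_comm, ← Finsupp.single_add,
      vertexSign_mul_erase h.1 h.2.2 h.2.1.symm, Finsupp.single_zero]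
  · rintro ⟨v, w⟩ h - h'
    simp only [mem_sigma, mem_erase] at h
    exact h.2.1 (congrArg Sigma.fst h')
  · rintro ⟨v, w⟩ h
    simp only [mem_sigma, mem_erase] at h ⊢
    exact ⟨h.2.2, h.2.1.symm, h.1⟩
  · rintro ⟨v, w⟩ _
    rfl

theorem finsetBoundary_single_apply_erase {s : Finset V} {v : V} (hv : v ∈ s) :
    finsetBoundary V (Finsupp.single s 1) (s.erase v) = vertexSign s v := by
  rw [finsetBoundary_single, one_smul, Finsupp.finsetSum_apply, Finset.sum_eq_single v]
  · simp
  · intro w hw hwv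
    rw [Finsupp.single_apply, if_neg]
    intro h
    exact hwv ((Finset.erase_inj s hw).mp h)
  · exact fun h => absurd hv h

theorem subset_of_finsetBoundary_single_apply_ne_zero {s ρ : Finset V}
    (h : finsetBoundary V (Finsupp.single s 1) ρ ≠ 0) : ρ ⊆ s := by
  by_contra hρ
  refine h ?_
  rw [finsetBoundary_single, one_smul, Finsupp.finsetSum_apply]
  refine Finset.sum_eq_zero fun w _ => ?_
  rw [Finsupp.single_apply, if_neg]
  rintro rfl
  exact hρ (erase_subset _ _)

end AbstractSimplicialComplex

/-- If a family of vectors is triangular with invertible pivots, then every integer dividing a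
linear combination divides its coefficients. -/
theorem dvd_of_dvd_linearCombination_of_triangular {I κ : Type*} (b : I → κ →₀ ℤ) (ρ : I → κ)
    (h : I → ℕ) (hu : ∀ i, IsUnit (b i (ρ i)))
    (ht : ∀ i j, j ≠ i → b j (ρ i) ≠ 0 → h j < h i) (N : ℤ) (e : I →₀ ℤ)
    (he : ∀ x, N ∣ Finsupp.linearCombination ℤ b e x) (i : I) : N ∣ e i := by
  classical
  -- At the pivot coordinate of `i` all other contributions come from vectors of smaller height,
  -- whose coefficients are already known to be divisible.
  induction hn : h i using Nat.strong_induction_on generalizing i with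
  | _ n ih =>
    subst hn
    have h1 := he (ρ i)
    rw [Finsupp.linearCombination_apply, Finsupp.sum, Finsupp.finsetSum_apply] at h1
    have h2 : ∀ j, j ≠ i → N ∣ (e j • b j) (ρ i) := by
      intro j hj
      rw [Finsupp.smul_apply, smul_eq_mul]
      by_cases h0 : b j (ρ i) = 0
      · rw [h0, mul_zero]; exact dvd_zero _
      · exact Dvd.dvd.mul_right (ih _ (ht i j hj h0) j rfl) _
    by_cases hi : i ∈ e.support
    · rw [← Finset.add_sum_erase _ _ hi] at h1
      have h3 := (dvd_add_left (Finset.dvd_sum fun j hj => h2 j (Finset.ne_of_mem_erase hj))).mp h1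
      rw [Finsupp.smul_apply, smul_eq_mul] at h3
      exact (hu i).dvd_mul_right.mp h3
    · rw [Finsupp.notMem_support_iff.mp hi]; exact dvd_zero _

namespace AbstractSimplicialComplex

/-- A family of simplices `τ t` with `k + 4` vertices. The facets opposite to the vertices in
`A t` are the virtual facets `σ u`; together they satisfy the relation `rel t`. -/
structure SimplexSystem (V T U : Type*) [LinearOrder V] (k : ℕ) where
  /-- The simplices. -/
  τ : T → Finset V
  /-- The vertices opposite to virtual facets. -/
  A : T → Finset V
  /-- The virtual facets. -/
  σ : U → Finset V
  /-- The relation between the boundaries of the virtual facets given by a simplex. -/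
  rel : T → U →₀ ℤ
  A_subset : ∀ t, A t ⊆ τ t
  exists_notMem : ∀ t, ∃ i ∈ τ t, i ∉ A t
  card_τ : ∀ t, (τ t).card = k + 4
  card_σ : ∀ u, (σ u).card = k + 3
  mapDomain_rel : ∀ t, Finsupp.mapDomain σ (rel t) =
    ∑ a ∈ A t, Finsupp.single ((τ t).erase a) (vertexSign (τ t) a)
  eq_of_subset : ∀ t t' ρ, ρ.card = k + 2 → A t ⊆ ρ → ρ ⊆ τ t → ρ ⊆ τ t' → t = t'
  not_subset : ∀ t u ρ, ρ.card = k + 2 → A t ⊆ ρ → ρ ⊆ τ t → ¬ ρ ⊆ σ u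
  exists_ridge : ∀ u, ∃ v ∈ σ u, ∀ u', (σ u).erase v ⊆ σ u' → u' = u

namespace SimplexSystem

variable {V T U : Type*} [LinearOrder V] {k : ℕ} (S : SimplexSystem V T U k)

/-- The group spanned by the boundaries of the real facets. -/
def realBoundaries : Submodule ℤ (Finset V →₀ ℤ) :=
  Submodule.span ℤ {x | ∃ t, ∃ i ∈ S.τ t, i ∉ S.A t ∧
    x = finsetBoundary V (Finsupp.single ((S.τ t).erase i) 1)}

/-- The boundary of a combination of virtual facets. -/
def virtualBoundary : (U →₀ ℤ) →ₗ[ℤ] (Finset V →₀ ℤ) :=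
  finsetBoundary V ∘ₗ Finsupp.lmapDomain ℤ ℤ S.σ

theorem virtualBoundary_single (u : U) : S.virtualBoundary (Finsupp.single u 1) =
    finsetBoundary V (Finsupp.single (S.σ u) 1) := by
  simp [virtualBoundary]

/-- This is `∂∂ = 0` for the simplex `τ t`, split into virtual and real facets: once the real facets
are filled, `rel t` becomes a homology between the virtual boundaries. -/
theorem virtualBoundary_rel (t : T) : S.virtualBoundary (S.rel t) +
    ∑ v ∈ S.τ t \ S.A t, vertexSign (S.τ t) v •
      finsetBoundary V (Finsupp.single ((S.τ t).erase v) 1) = 0 := by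
  have h := finsetBoundary_finsetBoundary (Finsupp.single (S.τ t) 1)
  rw [finsetBoundary_single, one_smul, ← Finset.sum_sdiff (S.A_subset t), map_add, map_sum,
    ← S.mapDomain_rel, add_comm] at h
  rw [← h]
  simp only [virtualBoundary, LinearMap.comp_apply, Finsupp.lmapDomain_apply]
  congr 1
  refine Finset.sum_congr rfl fun v _ => ?_
  rw [← map_smul, Finsupp.smul_single, smul_eq_mul, mul_one]

/-- A vertex of `τ t` opposite to a real facet that is redundant modulo the other facets. -/
def base (t : T) : V := (S.exists_notMem t).choose

theorem base_mem (t : T) : S.base t ∈ S.τ t := (S.exists_notMem t).choose_spec.1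

theorem base_notMem (t : T) : S.base t ∉ S.A t := (S.exists_notMem t).choose_spec.2

/-- The real facets other than the redundant ones. -/
abbrev Essential : Type _ :=
  {p : T × V // p.2 ∈ S.τ p.1 ∧ p.2 ∉ S.A p.1 ∧ p.2 ≠ S.base p.1}

/-- The essential real facets and the virtual facets. -/
def facet : S.Essential ⊕ U → Finset V :=
  Sum.elim (fun p => (S.τ p.1.1).erase p.1.2) S.σ

/-- The boundary on combinations of essential real facets and virtual facets. -/
def facetBoundary : (S.Essential ⊕ U →₀ ℤ) →ₗ[ℤ] (Finset V →₀ ℤ) :=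
  Finsupp.linearCombination ℤ fun i => finsetBoundary V (Finsupp.single (S.facet i) 1)

theorem facetBoundary_single (i : S.Essential ⊕ U) : S.facetBoundary (Finsupp.single i 1) =
    finsetBoundary V (Finsupp.single (S.facet i) 1) := by
  simp [facetBoundary]

/-- The vertex removed from a facet to get its pivot. -/
def pivotVertex : S.Essential ⊕ U → V :=
  Sum.elim (fun p => S.base p.1.1) (fun u => (S.exists_ridge u).choose)

theorem pivotVertex_mem (i : S.Essential ⊕ U) : S.pivotVertex i ∈ S.facet i := by
  rcases i with p | u
  · exact mem_erase.mpr ⟨p.2.2.2.symm, S.base_mem _⟩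
  · exact (S.exists_ridge u).choose_spec.1

/-- The pivot of an essential real facet is `τ t` without the removed vertex and the base vertex. It
contains `A t`, so it lies in no facet of another simplex and in no virtual facet; the exclusion of
the base vertex handles the facets of the same simplex. The pivot of a virtual facet lies in no
other virtual facet but perhaps in real ones, whence the heights `0` and `1`. The case `N = 0` gives
injectivity, the case `N ≠ 0` purity. -/
theorem dvd_of_dvd_facetBoundary (N : ℤ) (e : S.Essential ⊕ U →₀ ℤ)
    (he : ∀ x, N ∣ S.facetBoundary e x) (i : S.Essential ⊕ U) : N ∣ e i := by
  refine dvd_of_dvd_linearCombination_of_triangular _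
    (fun i => (S.facet i).erase (S.pivotVertex i)) (Sum.elim (fun _ => 0) (fun _ => 1))
    (fun i => ?_) (fun i j hij h0 => ?_) N e he i
  · rw [finsetBoundary_single_apply_erase (S.pivotVertex_mem i)]
    exact vertexSign_isUnit _ _
  · have hsub := subset_of_finsetBoundary_single_apply_ne_zero h0
    rcases i with p | u
    · exfalso
      have hc : ((S.facet (Sum.inl p)).erase (S.pivotVertex (Sum.inl p))).card = k + 2 := by
        rw [card_erase_of_mem (S.pivotVertex_mem _), facet, Sum.elim_inl,
          card_erase_of_mem p.2.1, S.card_τ]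
        rfl
      have hA : S.A p.1.1 ⊆ (S.facet (Sum.inl p)).erase (S.pivotVertex (Sum.inl p)) := by
        intro a ha
        refine mem_erase.mpr ⟨fun h => S.base_notMem p.1.1 (by rw [h] at ha; exact ha), mem_erase.mpr ⟨fun h =>
          p.2.2.1 (h ▸ ha), S.A_subset _ ha⟩⟩
      have hτ : (S.facet (Sum.inl p)).erase (S.pivotVertex (Sum.inl p)) ⊆ S.τ p.1.1 :=
        (erase_subset _ _).trans (erase_subset _ _)
      rcases j with p' | u'
      · have ht := S.eq_of_subset _ _ _ hc hA hτ (hsub.trans (erase_subset _ _))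
        refine hij (congrArg Sum.inl (Subtype.ext (Prod.ext ht.symm ?_)))
        by_contra hne
        have : p'.1.2 ∈ (S.facet (Sum.inl p)).erase (S.pivotVertex (Sum.inl p)) := by
          refine mem_erase.mpr ⟨fun h => p'.2.2.2 ?_, mem_erase.mpr ⟨hne, ht ▸ p'.2.1⟩⟩
          rw [h, ← ht]
          rfl
        exact notMem_erase _ _ (hsub this)
      · exact S.not_subset _ _ _ hc hA hτ hsub
    · rcases j with p' | u'
      · exact Nat.zero_lt_one
      · exact absurd (congrArg Sum.inr ((S.exists_ridge u).choose_spec.2 u' hsub)) hij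

theorem facetBoundary_injective : Function.Injective S.facetBoundary := by
  rw [← LinearMap.ker_eq_bot, LinearMap.ker_eq_bot']
  intro e he
  ext i
  exact zero_dvd_iff.mp (S.dvd_of_dvd_facetBoundary 0 e (by simp [he]) i)

theorem virtualBoundary_eq (e : U →₀ ℤ) :
    S.virtualBoundary e = S.facetBoundary (Finsupp.mapDomain Sum.inr e) := by
  suffices h : S.virtualBoundary = S.facetBoundary ∘ₗ Finsupp.lmapDomain ℤ ℤ Sum.inr from
    LinearMap.congr_fun h e
  refine Finsupp.lhom_ext' fun u => LinearMap.ext_ring ?_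
  simp [virtualBoundary_single, facetBoundary_single, facet]

/-- Every boundary of real facets is a boundary of essential real facets and a combination of
relations of virtual facets. -/
theorem realBoundaries_le : S.realBoundaries ≤
    ((Submodule.span ℤ (Set.range S.rel)).comap
      (Finsupp.lcomapDomain Sum.inr Sum.inr_injective)).map S.facetBoundary := by
  set P := ((Submodule.span ℤ (Set.range S.rel)).comap
      (Finsupp.lcomapDomain Sum.inr Sum.inr_injective)).map S.facetBoundary with hP
  have hess : ∀ t, ∀ i ∈ S.τ t, i ∉ S.A t → i ≠ S.base t →
      finsetBoundary V (Finsupp.single ((S.τ t).erase i) 1) ∈ P := by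
    intro t i hi hA hb
    refine ⟨Finsupp.single (Sum.inl ⟨(t, i), hi, hA, hb⟩) 1, ?_, S.facetBoundary_single _⟩
    have : Finsupp.lcomapDomain (R := ℤ) (M := ℤ) Sum.inr Sum.inr_injective
        (Finsupp.single (Sum.inl ⟨(t, i), hi, hA, hb⟩ : S.Essential ⊕ U) 1) = 0 := by
      ext u
      simp [Finsupp.lcomapDomain]
    simp only [SetLike.mem_coe, Submodule.mem_comap]
    rw [this]
    exact zero_mem _
  have hrel : ∀ t, S.virtualBoundary (S.rel t) ∈ P := by
    intro t
    rw [virtualBoundary_eq]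
    refine ⟨_, ?_, rfl⟩
    have : Finsupp.lcomapDomain (R := ℤ) (M := ℤ) Sum.inr Sum.inr_injective
        (Finsupp.mapDomain (Sum.inr : U → S.Essential ⊕ U) (S.rel t)) = S.rel t := by
      ext u
      simp [Finsupp.lcomapDomain, Finsupp.mapDomain_apply Sum.inr_injective]
    simp only [SetLike.mem_coe, Submodule.mem_comap]
    rw [this]
    exact Submodule.subset_span ⟨t, rfl⟩
  refine Submodule.span_le.mpr ?_
  rintro _ ⟨t, i, hi, hA, rfl⟩
  by_cases hb : i = S.base t
  · subst hb
    -- The relation of `τ t` expresses the boundary opposite to the base vertex through `rel t` and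
    -- the essential facets.
    have h := S.virtualBoundary_rel t
    rw [← Finset.add_sum_erase _ _ (mem_sdiff.mpr ⟨hi, hA⟩)] at h
    have h2 : vertexSign (S.τ t) (S.base t) •
        finsetBoundary V (Finsupp.single ((S.τ t).erase (S.base t)) 1) ∈ P := by
      have h3 : ∑ v ∈ (S.τ t \ S.A t).erase (S.base t), vertexSign (S.τ t) v •
          finsetBoundary V (Finsupp.single ((S.τ t).erase v) 1) ∈ P := by
        refine sum_mem fun v hv => P.smul_mem _ ?_
        simp only [mem_erase, mem_sdiff] at hv
        exact hess t v hv.2.1 hv.2.2 hv.1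
      have h4 := P.neg_mem (P.add_mem (hrel t) h3)
      convert h4 using 1
      rw [eq_neg_iff_add_eq_zero, ← h]
      abel
    have h5 := P.smul_mem (vertexSign (S.τ t) (S.base t)) h2
    rwa [smul_smul, vertexSign_mul_self, one_smul] at h5
  · exact hess t i hi hA hb

/-- No relation holds beyond those imposed: a virtual combination bounding real facets has two
preimages under the injective `facetBoundary`, and comparing their virtual components puts it in the
span of the relations. -/
theorem virtualBoundary_mem_realBoundaries_iff (e : U →₀ ℤ) :
    S.virtualBoundary e ∈ S.realBoundaries ↔ e ∈ Submodule.span ℤ (Set.range S.rel) := by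
  constructor
  · intro h
    obtain ⟨w, hw, hwe⟩ := S.realBoundaries_le h
    rw [virtualBoundary_eq] at hwe
    rw [S.facetBoundary_injective hwe] at hw
    simp only [SetLike.mem_coe, Submodule.mem_comap] at hw
    convert hw using 1
    ext u
    simp [Finsupp.lcomapDomain, Finsupp.mapDomain_apply Sum.inr_injective]
  · intro h
    suffices h' : Submodule.span ℤ (Set.range S.rel) ≤ S.realBoundaries.comap S.virtualBoundary
      from h' h
    refine Submodule.span_le.mpr ?_
    rintro _ ⟨t, rfl⟩
    simp only [SetLike.mem_coe, Submodule.mem_comap]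
    rw [eq_neg_of_add_eq_zero_left (S.virtualBoundary_rel t)]
    refine neg_mem (sum_mem fun v hv => Submodule.smul_mem _ _ (Submodule.subset_span ?_))
    rw [mem_sdiff] at hv
    exact ⟨t, v, hv.1, hv.2, rfl⟩

theorem sup_eq_range : S.realBoundaries ⊔ LinearMap.range S.virtualBoundary =
    LinearMap.range S.facetBoundary := by
  refine le_antisymm (sup_le ?_ ?_) ?_
  · exact S.realBoundaries_le.trans LinearMap.map_le_range
  · rintro _ ⟨e, rfl⟩
    exact ⟨_, (S.virtualBoundary_eq e).symm⟩
  · rw [facetBoundary, Finsupp.range_linearCombination, Submodule.span_le]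
    rintro _ ⟨p | u, rfl⟩
    · exact Submodule.mem_sup_left (Submodule.subset_span ⟨p.1.1, p.1.2, p.2.1, p.2.2.1, rfl⟩)
    · exact Submodule.mem_sup_right ⟨Finsupp.single u 1, S.virtualBoundary_single u⟩

/-- The real and virtual boundaries together span a pure subgroup of all chains, since the
coefficients of a combination divisible by `N` are themselves divisible by `N`. -/
theorem mem_sup_of_smul_mem {N : ℤ} (hN : N ≠ 0) {c : Finset V →₀ ℤ}
    (hc : N • c ∈ S.realBoundaries ⊔ LinearMap.range S.virtualBoundary) :
    c ∈ S.realBoundaries ⊔ LinearMap.range S.virtualBoundary := by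
  rw [sup_eq_range] at hc ⊢
  obtain ⟨w, hw⟩ := hc
  have hd := S.dvd_of_dvd_facetBoundary N w (by simp [hw])
  refine ⟨w.mapRange (· / N) (Int.zero_ediv N), ?_⟩
  have hw' : w = N • w.mapRange (· / N) (Int.zero_ediv N) := by
    ext i
    simp [Int.mul_ediv_cancel' (hd i)]
  rw [hw', map_smul] at hw
  exact smul_right_injective _ hN hw

end SimplexSystem

end AbstractSimplicialComplex

end

/-! ### Torsion in the homology of the complex of real facets. -/

noncomputable section

open Finset

/-- Two homomorphisms with the same kernel, one surjective and the other with pure range, have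
codomains with isomorphic torsion. -/
theorem nonempty_torsion_addEquiv {E H M : Type*} [AddCommGroup E] [AddCommGroup H]
    [AddCommGroup M] (θ : E →+ H) (Λ : E →+ M) (hΛ : Function.Surjective Λ)
    (hker : ∀ e, θ e = 0 ↔ Λ e = 0)
    (hpure : ∀ h : H, ∀ n : ℕ, 0 < n → n • h ∈ θ.range → h ∈ θ.range) :
    Nonempty (AddCommGroup.torsion H ≃+ AddCommGroup.torsion M) := by
  have hk : Λ.ker ≤ θ.ker := fun e he => (hker e).mpr he
  set φ : M →+ H := Λ.liftOfSurjective hΛ ⟨θ, hk⟩ with hφ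
  have hφΛ : ∀ e, φ (Λ e) = θ e := fun e =>
    AddMonoidHom.liftOfRightInverse_comp_apply Λ _ _ ⟨θ, hk⟩ e
  have hinj : Function.Injective φ := by
    rw [injective_iff_map_eq_zero]
    intro m hm
    obtain ⟨e, rfl⟩ := hΛ m
    rw [hφΛ] at hm
    exact (hker e).mp hm
  have hmem : ∀ m : AddCommGroup.torsion M, φ m ∈ AddCommGroup.torsion H := by
    rintro ⟨m, hm⟩
    exact AddMonoidHom.isOfFinAddOrder φ hm
  refine ⟨(AddEquiv.ofBijective ((φ.comp (AddSubgroup.subtype _)).codRestrict _ hmem)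
    ⟨?_, ?_⟩).symm⟩
  · intro a b hab
    exact Subtype.ext (hinj (congrArg Subtype.val hab))
  · rintro ⟨h, hh⟩
    obtain ⟨n, hn, hn0⟩ := isOfFinAddOrder_iff_nsmul_eq_zero.mp hh
    -- Purity applied to `n • h = 0` puts every torsion element into the range.
    obtain ⟨e, he⟩ := hpure h n hn (by rw [hn0]; exact zero_mem _)
    refine ⟨⟨Λ e, ?_⟩, Subtype.ext ((hφΛ e).trans he)⟩
    refine isOfFinAddOrder_iff_nsmul_eq_zero.mpr ⟨n, hn, hinj ?_⟩
    rw [map_nsmul, hφΛ, he, hn0, map_zero]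

namespace AbstractSimplicialComplex

variable {V : Type*} (K : AbstractSimplicialComplex V)

/-- The inclusion of the chains of a complex into the combinations of all finite sets. -/
def chainIncl (k : ℕ) : K.Chain k →ₗ[ℤ] (Finset V →₀ ℤ) :=
  Finsupp.lmapDomain ℤ ℤ fun s : K.Simplex k => s.1

theorem chainIncl_single {k : ℕ} (s : K.Simplex k) (a : ℤ) :
    K.chainIncl k (Finsupp.single s a) = Finsupp.single s.1 a := by
  simp [chainIncl]

theorem chainIncl_injective (k : ℕ) : Function.Injective (K.chainIncl k) :=
  Finsupp.mapDomain_injective Subtype.val_injective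

variable [LinearOrder V]

theorem chainIncl_boundary (k : ℕ) (x : K.Chain (k + 1)) :
    K.chainIncl k (K.boundary k x) = finsetBoundary V (K.chainIncl (k + 1) x) := by
  suffices h : K.chainIncl k ∘ₗ K.boundary k = finsetBoundary V ∘ₗ K.chainIncl (k + 1) from
    LinearMap.congr_fun h x
  refine Finsupp.lhom_ext' fun s => LinearMap.ext_ring ?_
  simp only [LinearMap.comp_apply, Finsupp.lsingle_apply, boundary, chainIncl_single,
    Finsupp.linearCombination_single, one_smul, map_sum, finsetBoundary_single]
  exact Finset.sum_coe_sort s.1 fun v => Finsupp.single (s.1.erase v) (vertexSign s.1 v)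

theorem exists_chainIncl_eq {k : ℕ} {s : Finset V} (hs : s.card = k + 2)
    (h : ∀ v ∈ s, s.erase v ∈ K.faces) :
    ∃ c : K.Chain k, K.chainIncl k c = finsetBoundary V (Finsupp.single s 1) := by
  refine ⟨∑ v : {v // v ∈ s}, Finsupp.single ⟨s.erase v.1, h v.1 v.2, by
    rw [card_erase_of_mem v.2, hs]; rfl⟩ (vertexSign s v.1), ?_⟩
  rw [map_sum, finsetBoundary_single, one_smul]
  refine (Finset.sum_congr rfl fun v _ => K.chainIncl_single _ _).trans ?_
  exact Finset.sum_coe_sort s fun v => Finsupp.single (s.erase v) (vertexSign s v)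

theorem mem_cycles_succ_iff {k : ℕ} (c : K.Chain (k + 1)) :
    c ∈ K.cycles (k + 1) ↔ finsetBoundary V (K.chainIncl (k + 1) c) = 0 := by
  rw [← chainIncl_boundary]
  change K.boundary k c = 0 ↔ _
  rw [← (K.chainIncl_injective k).eq_iff, map_zero]

namespace SimplexSystem

variable {T U M : Type*} {k : ℕ} (S : SimplexSystem V T U k) {K}

theorem map_range_boundary
    (hfacet : ∀ s, s.card = k + 3 → (s ∈ K.faces ↔ ∃ t, ∃ i ∈ S.τ t, i ∉ S.A t ∧
      s = (S.τ t).erase i)) :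
    (LinearMap.range (K.boundary (k + 1))).map (K.chainIncl (k + 1)) = S.realBoundaries := by
  have h : K.chainIncl (k + 1) ∘ₗ K.boundary (k + 1) =
      Finsupp.linearCombination ℤ fun s : K.Simplex (k + 2) =>
        finsetBoundary V (Finsupp.single s.1 1) := by
    refine Finsupp.lhom_ext' fun s => LinearMap.ext_ring ?_
    simp [chainIncl_boundary, chainIncl_single]
  rw [← LinearMap.range_comp, h, Finsupp.range_linearCombination, realBoundaries]
  congr 1
  ext x
  constructor
  · rintro ⟨s, rfl⟩
    obtain ⟨t, i, hi, hA, hs⟩ := (hfacet s.1 s.2.2).mp s.2.1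
    exact ⟨t, i, hi, hA, by rw [← hs]⟩
  · rintro ⟨t, i, hi, hA, rfl⟩
    have hc : ((S.τ t).erase i).card = k + 3 := by
      rw [card_erase_of_mem hi, S.card_τ]; rfl
    exact ⟨⟨(S.τ t).erase i, (hfacet _ hc).mpr ⟨t, i, hi, hA, rfl⟩, hc⟩, rfl⟩

/-- The torsion of the homology of the complex of real facets is the torsion of the group
presented by the virtual facets and their relations. -/
theorem nonempty_torsion_homology_addEquiv [AddCommGroup M]
    (hfacet : ∀ s, s.card = k + 3 → (s ∈ K.faces ↔ ∃ t, ∃ i ∈ S.τ t, i ∉ S.A t ∧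
      s = (S.τ t).erase i))
    (hσ : ∀ u, ∀ v ∈ S.σ u, (S.σ u).erase v ∈ K.faces)
    (Λ : (U →₀ ℤ) →ₗ[ℤ] M) (hΛ : Function.Surjective Λ)
    (hker : LinearMap.ker Λ = Submodule.span ℤ (Set.range S.rel)) :
    Nonempty (AddCommGroup.torsion (K.Homology (k + 1)) ≃+ AddCommGroup.torsion M) := by
  choose c hc using fun u => K.exists_chainIncl_eq (k := k + 1) (S.card_σ u) (hσ u)
  have hcyc : ∀ u, c u ∈ K.cycles (k + 1) := fun u => by
    rw [mem_cycles_succ_iff, hc, finsetBoundary_finsetBoundary]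
  set Z : (U →₀ ℤ) →ₗ[ℤ] K.cycles (k + 1) :=
    Finsupp.linearCombination ℤ fun u => (⟨c u, hcyc u⟩ : K.cycles (k + 1)) with hZ
  have hincl : ∀ e, K.chainIncl (k + 1) (Z e).1 = S.virtualBoundary e := by
    intro e
    suffices h : K.chainIncl (k + 1) ∘ₗ (K.cycles (k + 1)).subtype ∘ₗ Z = S.virtualBoundary from
      LinearMap.congr_fun h e
    refine Finsupp.lhom_ext' fun u => LinearMap.ext_ring ?_
    simp [hZ, hc, virtualBoundary_single]
  have hmem : ∀ x : K.cycles (k + 1),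
      x ∈ (LinearMap.range (K.boundary (k + 1))).submoduleOf (K.cycles (k + 1)) ↔
        K.chainIncl (k + 1) x.1 ∈ S.realBoundaries := by
    intro x
    rw [← S.map_range_boundary hfacet]
    exact (Function.Injective.mem_set_image (K.chainIncl_injective (k + 1))
      (s := (LinearMap.range (K.boundary (k + 1)) : Set _)) (a := x.1)).symm
  -- A generator goes to the homology class of the boundary of its virtual facet.
  set θ : (U →₀ ℤ) →ₗ[ℤ] K.Homology (k + 1) := (Submodule.mkQ _) ∘ₗ Z with hθ
  refine nonempty_torsion_addEquiv θ.toAddMonoidHom Λ.toAddMonoidHom hΛ (fun e => ?_) ?_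
  · change θ e = 0 ↔ e ∈ LinearMap.ker Λ
    rw [hker, ← virtualBoundary_mem_realBoundaries_iff, ← hincl, ← hmem, hθ, LinearMap.comp_apply,
      Submodule.mkQ_apply, Submodule.Quotient.mk_eq_zero]
  · intro h n hn hh
    obtain ⟨x, rfl⟩ := Submodule.mkQ_surjective _ h
    obtain ⟨e, he⟩ := hh
    have he' : Submodule.Quotient.mk (Z e) = Submodule.Quotient.mk (n • x) := he
    rw [Submodule.Quotient.eq, hmem] at he'
    -- Purity of the image in homology follows from purity of the real and virtual boundaries among
    -- all chains, so the group of cycles needs no separate study.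
    have h1 : (n : ℤ) • K.chainIncl (k + 1) x.1 ∈
        S.realBoundaries ⊔ LinearMap.range S.virtualBoundary := by
      have : (n : ℤ) • K.chainIncl (k + 1) x.1 =
          -(K.chainIncl (k + 1) (Z e - n • x).1) + S.virtualBoundary e := by
        rw [← hincl]
        simp
      rw [this]
      exact add_mem (Submodule.mem_sup_left (neg_mem he')) (Submodule.mem_sup_right ⟨e, rfl⟩)
    obtain ⟨y, hy, _, ⟨e', rfl⟩, hyz⟩ :=
      Submodule.mem_sup.mp (S.mem_sup_of_smul_mem (by exact_mod_cast hn.ne') h1)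
    refine ⟨e', ?_⟩
    change Submodule.Quotient.mk (Z e') = Submodule.Quotient.mk x
    rw [Submodule.Quotient.eq, hmem]
    have : K.chainIncl (k + 1) (Z e' - x).1 = -y := by
      rw [Submodule.coe_sub, map_sub, hincl, ← hyz]
      abel
    rw [this]
    exact neg_mem hy

end SimplexSystem

end AbstractSimplicialComplex

end

/-! ### The complex of a simplex system, and the combinatorics of the gadgets. -/

noncomputable section

open Finset

namespace AbstractSimplicialComplex

/-- Exactly one more vertex, namely `a`, lies below `b` than below `a`. -/
theorem vertexSign_eq_neg_of_covBy {V : Type*} [LinearOrder V] {s : Finset V} {a b : V}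
    (ha : a ∈ s) (hab : a < b) (h : ∀ c ∈ s, a < c → b ≤ c) :
    vertexSign s b = -vertexSign s a := by
  have : s.filter (· < b) = insert a (s.filter (· < a)) := by
    ext c
    simp only [mem_filter, mem_insert]
    constructor
    · rintro ⟨hc, hcb⟩
      rcases lt_trichotomy c a with h' | h' | h'
      · exact Or.inr ⟨hc, h'⟩
      · exact Or.inl h'
      · exact absurd hcb (not_lt.mpr (h c hc h'))
    · rintro (rfl | ⟨hc, hca⟩)
      · exact ⟨ha, hab⟩
      · exact ⟨hc, hca.trans hab⟩
  rw [vertexSign, this, card_insert_of_notMem (by simp), pow_succ, vertexSign]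
  ring

namespace SimplexSystem

variable {V T U : Type*} [LinearOrder V] {k : ℕ} (S : SimplexSystem V T U k)

/-- The complex whose maximal faces are the real facets, together with all their vertices and all
faces of the simplices that have at most `k + 2` vertices. -/
def complex : AbstractSimplicialComplex V where
  faces := {s | s.Nonempty ∧ ((∃ v, s = {v}) ∨ (∃ u, s ⊆ S.σ u ∧ s.card ≤ k + 2) ∨
    ∃ t, ∃ i ∈ S.τ t, i ∉ S.A t ∧ s ⊆ (S.τ t).erase i)}
  isRelLowerSet_faces := by
    rintro s ⟨hs, h⟩
    refine ⟨hs, fun s' hs' hne => ⟨hne, ?_⟩⟩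
    rcases h with ⟨v, rfl⟩ | ⟨u, hu, hc⟩ | ⟨t, i, hi, hA, hsub⟩
    · exact Or.inl ⟨v, (subset_singleton_iff.mp hs').resolve_left hne.ne_empty⟩
    · exact Or.inr (Or.inl ⟨u, hs'.trans hu, (card_le_card hs').trans hc⟩)
    · exact Or.inr (Or.inr ⟨t, i, hi, hA, hs'.trans hsub⟩)
  singleton_mem v := ⟨singleton_nonempty v, Or.inl ⟨v, rfl⟩⟩

theorem nonempty_torsion_homology_complex_addEquiv {M : Type*} [AddCommGroup M]
    (Λ : (U →₀ ℤ) →ₗ[ℤ] M) (hΛ : Function.Surjective Λ)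
    (hker : LinearMap.ker Λ = Submodule.span ℤ (Set.range S.rel)) :
    Nonempty (AddCommGroup.torsion (S.complex.Homology (k + 1)) ≃+ AddCommGroup.torsion M) := by
  refine S.nonempty_torsion_homology_addEquiv (fun s hs => ⟨?_, ?_⟩) (fun u v hv => ?_) Λ hΛ hker
  · rintro ⟨-, ⟨v, rfl⟩ | ⟨u, hu, hc⟩ | ⟨t, i, hi, hA, hsub⟩⟩
    · rw [card_singleton] at hs; omega
    · omega
    · refine ⟨t, i, hi, hA, eq_of_subset_of_card_le hsub ?_⟩
      rw [card_erase_of_mem hi, S.card_τ, hs]; rfl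
  · rintro ⟨t, i, hi, hA, rfl⟩
    exact ⟨card_pos.mp (by omega), Or.inr (Or.inr ⟨t, i, hi, hA, Subset.rfl⟩)⟩
  · have hc : ((S.σ u).erase v).card = k + 2 := by rw [card_erase_of_mem hv, S.card_σ]; rfl
    exact ⟨card_pos.mp (by omega), Or.inr (Or.inl ⟨u, erase_subset _ _, hc.le⟩)⟩

end SimplexSystem

end AbstractSimplicialComplex

/-! ### The simplices realizing a presentation by relations with three terms -/

namespace Gadget

variable {N R : Type*} {k : ℕ}

/-- The vertices: those of a simplex for each generator and of a simplex for each relation. -/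
abbrev Vertex (N R : Type*) (k : ℕ) : Type _ := N × Fin (k + 3) ⊕ R × Fin (k + 4)

/-- The position of a vertex in the simplices containing it. -/
def height : Vertex N R k → ℕ
  | Sum.inl v => v.2
  | Sum.inr v => k + 3 + v.2

theorem height_lt (v : Vertex N R k) : height v < 2 * k + 7 := by
  rcases v with ⟨n, i⟩ | ⟨r, i⟩
  · simp only [height]; omega
  · simp only [height]; omega

/-- The increasing enumeration of the vertices of the facet opposite to the vertex `a`. -/
def opp (a : Fin 3) (i : Fin (k + 3)) : Fin (k + 4) := (a.castLE (by omega)).succAbove i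

theorem opp_val (a : Fin 3) (i : Fin (k + 3)) :
    (opp a i : ℕ) = if (i : ℕ) < a then (i : ℕ) else i + 1 := by
  unfold opp Fin.succAbove
  simp only [Fin.lt_def, Fin.val_castSucc, Fin.val_castLE]
  split_ifs <;> simp

theorem opp_injective (a : Fin 3) : Function.Injective (opp (k := k) a) :=
  Fin.succAbove_right_injective

theorem opp_ne_castLE (a : Fin 3) (i : Fin (k + 3)) : opp a i ≠ a.castLE (by omega) :=
  Fin.succAbove_ne _ _

variable [DecidableEq N] [DecidableEq R] (x : R → Fin 3 → N)

/-- The simplices: one for each relation, and those triangulating a cylinder between each of its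
first three facets and the simplex of the corresponding generator. -/
def simplex : R ⊕ R × Fin 3 × Fin (k + 3) → Finset (Vertex N R k)
  | Sum.inl r => univ.image fun i => Sum.inr (r, i)
  | Sum.inr (r, a, j) => (Iic j).image (fun i => Sum.inl (x r a, i)) ∪
      (Ici j).image fun i => Sum.inr (r, opp a i)

/-- The vertices opposite to virtual facets. -/
def special : R ⊕ R × Fin 3 × Fin (k + 3) → Finset (Vertex N R k)
  | Sum.inl r => univ.image fun a : Fin 3 => Sum.inr (r, a.castLE (by omega))
  | Sum.inr (r, a, j) => {Sum.inl (x r a, j), Sum.inr (r, opp a j)}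

/-- The virtual facets: the simplices of the generators and the slices of the cylinders. -/
def virtual : N ⊕ R × Fin 3 × Fin (k + 3) → Finset (Vertex N R k)
  | Sum.inl n => univ.image fun i => Sum.inl (n, i)
  | Sum.inr (r, a, j) => (Iio j).image (fun i => Sum.inl (x r a, i)) ∪
      (Ici j).image fun i => Sum.inr (r, opp a i)

section Membership

variable {x}

@[simp] theorem inl_mem_simplex_inl {r : R} {v : N × Fin (k + 3)} :
    Sum.inl v ∈ simplex (k := k) x (Sum.inl r) ↔ False := by
  simp [simplex]

@[simp] theorem inr_mem_simplex_inl {r r' : R} {i : Fin (k + 4)} :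
    Sum.inr (r', i) ∈ simplex (k := k) x (Sum.inl r) ↔ r' = r := by
  simp [simplex, eq_comm]

@[simp] theorem inl_mem_simplex_inr {r : R} {a : Fin 3} {j i : Fin (k + 3)} {n : N} :
    Sum.inl (n, i) ∈ simplex (k := k) x (Sum.inr (r, a, j)) ↔ n = x r a ∧ i ≤ j := by
  simp only [simplex, mem_union, mem_image, mem_Iic, Sum.inl.injEq, Prod.mk.injEq, reduceCtorEq,
    and_false, exists_false, or_false]
  constructor
  · rintro ⟨i', h, h1, rfl⟩; exact ⟨h1.symm, h⟩
  · rintro ⟨h1, h⟩; exact ⟨i, h, h1.symm, rfl⟩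

@[simp] theorem inr_mem_simplex_inr {r r' : R} {a : Fin 3} {j : Fin (k + 3)} {i : Fin (k + 4)} :
    Sum.inr (r', i) ∈ simplex (k := k) x (Sum.inr (r, a, j)) ↔
      r' = r ∧ ∃ i', j ≤ i' ∧ opp a i' = i := by
  simp only [simplex, mem_union, mem_image, mem_Ici, Sum.inr.injEq, Prod.mk.injEq, reduceCtorEq,
    and_false, exists_false, false_or]
  constructor
  · rintro ⟨i', h, rfl, rfl⟩; exact ⟨rfl, i', h, rfl⟩
  · rintro ⟨rfl, i', h, rfl⟩; exact ⟨i', h, rfl, rfl⟩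

@[simp] theorem inl_mem_virtual_inl {n n' : N} {i : Fin (k + 3)} :
    Sum.inl (n', i) ∈ virtual (k := k) x (Sum.inl n) ↔ n' = n := by
  simp [virtual, eq_comm]

@[simp] theorem inr_mem_virtual_inl {n : N} {v : R × Fin (k + 4)} :
    Sum.inr v ∈ virtual (k := k) x (Sum.inl n) ↔ False := by
  simp [virtual]

@[simp] theorem inl_mem_virtual_inr {r : R} {a : Fin 3} {j i : Fin (k + 3)} {n : N} :
    Sum.inl (n, i) ∈ virtual (k := k) x (Sum.inr (r, a, j)) ↔ n = x r a ∧ i < j := by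
  simp only [virtual, mem_union, mem_image, mem_Iio, Sum.inl.injEq, Prod.mk.injEq, reduceCtorEq,
    and_false, exists_false, or_false]
  constructor
  · rintro ⟨i', h, h1, rfl⟩; exact ⟨h1.symm, h⟩
  · rintro ⟨h1, h⟩; exact ⟨i, h, h1.symm, rfl⟩

@[simp] theorem inr_mem_virtual_inr {r r' : R} {a : Fin 3} {j : Fin (k + 3)} {i : Fin (k + 4)} :
    Sum.inr (r', i) ∈ virtual (k := k) x (Sum.inr (r, a, j)) ↔
      r' = r ∧ ∃ i', j ≤ i' ∧ opp a i' = i := by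
  simp only [virtual, mem_union, mem_image, mem_Ici, Sum.inr.injEq, Prod.mk.injEq, reduceCtorEq,
    and_false, exists_false, false_or]
  constructor
  · rintro ⟨i', h, rfl, rfl⟩; exact ⟨rfl, i', h, rfl⟩
  · rintro ⟨rfl, i', h, rfl⟩; exact ⟨i', h, rfl, rfl⟩

end Membership

theorem card_simplex (t : R ⊕ R × Fin 3 × Fin (k + 3)) : #(simplex (k := k) x t) = k + 4 := by
  rcases t with r | ⟨r, a, j⟩
  · rw [simplex, card_image_of_injective _ (fun i j h => by simpa using h)]
    simp
  · rw [simplex, card_union_of_disjoint, card_image_of_injective _ (fun i j h => by simpa using h),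
      card_image_of_injective _ (fun i j h => opp_injective a (by simpa using h))]
    · rw [Fin.card_Iic, Fin.card_Ici]; omega
    · rw [disjoint_left]; simp

theorem card_virtual (u : N ⊕ R × Fin 3 × Fin (k + 3)) : #(virtual (k := k) x u) = k + 3 := by
  rcases u with n | ⟨r, a, j⟩
  · rw [virtual, card_image_of_injective _ (fun i j h => by simpa using h)]
    simp
  · rw [virtual, card_union_of_disjoint, card_image_of_injective _ (fun i j h => by simpa using h),
      card_image_of_injective _ (fun i j h => opp_injective a (by simpa using h))]
    · rw [Fin.card_Iio, Fin.card_Ici]; omega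
    · rw [disjoint_left]; simp

theorem special_subset (t : R ⊕ R × Fin 3 × Fin (k + 3)) :
    special (k := k) x t ⊆ simplex x t := by
  rcases t with r | ⟨r, a, j⟩
  · intro v hv
    simp only [special, mem_image, mem_univ, true_and] at hv
    obtain ⟨a, rfl⟩ := hv
    simp
  · intro v hv
    simp only [special, mem_insert, mem_singleton] at hv
    rcases hv with rfl | rfl
    · simp
    · simpa using ⟨j, le_rfl, rfl⟩

theorem card_special_le (t : R ⊕ R × Fin 3 × Fin (k + 3)) : #(special (k := k) x t) ≤ 3 := by
  rcases t with r | ⟨r, a, j⟩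
  · exact card_image_le.trans (by simp)
  · exact card_le_two.trans (by norm_num)

variable {x}

/-- The cylinder over the facet opposite to vertex `a` misses that vertex, so it cannot contain all
three special vertices of a relation simplex. Inside a cylinder the two vertices at level `j` occur
together only in the `j`-th simplex. Injectivity of `x r` recovers `a` from the generator. -/
theorem eq_of_special_subset_simplex (hx : ∀ r, Function.Injective (x r))
    {t t' : R ⊕ R × Fin 3 × Fin (k + 3)}
    (h : special (k := k) x t ⊆ simplex x t') : t = t' := by
  rcases t with r | ⟨r, a, j⟩
  · have h1 : ∀ a : Fin 3, (Sum.inr (r, a.castLE (by omega)) : Vertex N R k) ∈ simplex x t' :=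
      fun a => h (mem_image_of_mem _ (mem_univ a))
    rcases t' with r' | ⟨r', a', j'⟩
    · rw [inr_mem_simplex_inl.mp (h1 0)]
    · obtain ⟨-, i, -, hi⟩ := inr_mem_simplex_inr.mp (h1 a')
      exact absurd hi (opp_ne_castLE _ _)
  · have h1 : Sum.inl (x r a, j) ∈ simplex x t' := h (by simp [special])
    have h2 : Sum.inr (r, opp a j) ∈ simplex x t' := h (by simp [special])
    rcases t' with r' | ⟨r', a', j'⟩
    · exact absurd h1 (by simp)
    · rw [inl_mem_simplex_inr] at h1
      obtain ⟨rfl, i, hi, hi'⟩ := inr_mem_simplex_inr.mp h2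
      obtain rfl := hx _ h1.1
      obtain rfl := opp_injective _ hi'
      rw [le_antisymm h1.2 hi]

/-- A slice has its generator vertices strictly below its level and its relation vertices from that
level on, so it never contains both vertices of one level. -/
theorem not_special_subset_virtual (hx : ∀ r, Function.Injective (x r))
    {t : R ⊕ R × Fin 3 × Fin (k + 3)}
    {u : N ⊕ R × Fin 3 × Fin (k + 3)} : ¬ special (k := k) x t ⊆ virtual x u := by
  intro h
  rcases t with r | ⟨r, a, j⟩
  · have h1 : ∀ a : Fin 3, (Sum.inr (r, a.castLE (by omega)) : Vertex N R k) ∈ virtual x u :=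
      fun a => h (mem_image_of_mem _ (mem_univ a))
    rcases u with n | ⟨r', a', j'⟩
    · exact inr_mem_virtual_inl.mp (h1 0)
    · obtain ⟨-, i, -, hi⟩ := inr_mem_virtual_inr.mp (h1 a')
      exact absurd hi (opp_ne_castLE _ _)
  · have h1 : Sum.inl (x r a, j) ∈ virtual x u := h (by simp [special])
    have h2 : Sum.inr (r, opp a j) ∈ virtual x u := h (by simp [special])
    rcases u with n | ⟨r', a', j'⟩
    · exact inr_mem_virtual_inl.mp h2
    · rw [inl_mem_virtual_inr] at h1
      obtain ⟨rfl, i, hi, hi'⟩ := inr_mem_virtual_inr.mp h2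
      obtain rfl := hx _ h1.1
      obtain rfl := opp_injective _ hi'
      exact absurd hi (not_le.mpr h1.2)

theorem exists_ridge_virtual (hx : ∀ r, Function.Injective (x r))
    (u : N ⊕ R × Fin 3 × Fin (k + 3)) :
    ∃ v ∈ virtual (k := k) x u, ∀ u', (virtual x u).erase v ⊆ virtual x u' → u' = u := by
  rcases u with n | ⟨r, a, j⟩
  · refine ⟨Sum.inl (n, 0), by simp, fun u' h => ?_⟩
    have h1 : Sum.inl (n, Fin.last (k + 2)) ∈ virtual x u' := h (by simp [Fin.ext_iff])
    rcases u' with n' | ⟨r', a', j'⟩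
    · rw [inl_mem_virtual_inl.mp h1]
    · exact absurd (inl_mem_virtual_inr.mp h1).2 (not_lt.mpr (Fin.le_last _))
  · by_cases hj : j = 0
    -- This slice is a facet of the relation simplex. Removing the vertex at position `3` leaves two
    -- of the positions `0, 1, 2`, and these determine the missing one, `a`.
    · subst hj
      refine ⟨Sum.inr (r, opp a ⟨2, by omega⟩), by simp, fun u' h => ?_⟩
      have h1 : ∀ i : Fin (k + 3), i.1 ≠ 2 → Sum.inr (r, opp a i) ∈ virtual x u' := fun i hi =>
        h (mem_erase.mpr ⟨fun h => hi (congrArg Fin.val (opp_injective a (by simpa using h))),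
          by simp⟩)
      have h2 := h1 0 (by simp)
      have h3 := h1 ⟨1, by omega⟩ (by simp)
      rcases u' with n' | ⟨r', a', j'⟩
      · exact absurd h2 (by simp)
      · obtain ⟨rfl, i, hi, hi'⟩ := inr_mem_virtual_inr.mp h2
        obtain ⟨-, l, hl, hl'⟩ := inr_mem_virtual_inr.mp h3
        have g1 := congrArg Fin.val hi'
        have g2 := congrArg Fin.val hl'
        simp only [opp_val, Fin.val_zero] at g1 g2
        have ha : a' = a := by
          ext
          have := a.2
          have := a'.2
          grind
        subst ha
        have := opp_injective _ hi'
        subst this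
        rw [Fin.le_zero_iff.mp hi]
    -- The generator vertex at level `j - 1` and the relation vertex at level `j` pin down the
    -- slice. There are at least three vertices, so some ridge keeps both.
    · have hpos : 0 < (j : ℕ) := Nat.pos_of_ne_zero fun h => hj (Fin.ext h)
      set j' : Fin (k + 3) := ⟨j - 1, by omega⟩ with hj'
      have hjj : j' < j := by rw [Fin.lt_def]; simp only [hj']; omega
      obtain ⟨v, hv, hv'⟩ : ∃ v ∈ virtual (k := k) x (Sum.inr (r, a, j)),
          v ∉ ({Sum.inl (x r a, j'), Sum.inr (r, opp a j)} : Finset (Vertex N R k)) := by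
        refine exists_mem_notMem_of_card_lt_card (lt_of_le_of_lt card_le_two ?_)
        rw [card_virtual]; omega
      simp only [mem_insert, mem_singleton, not_or] at hv'
      refine ⟨v, hv, fun u' h => ?_⟩
      have h1 : Sum.inl (x r a, j') ∈ virtual x u' :=
        h (mem_erase.mpr ⟨Ne.symm hv'.1, by simpa using hjj⟩)
      have h2 : Sum.inr (r, opp a j) ∈ virtual x u' :=
        h (mem_erase.mpr ⟨Ne.symm hv'.2, by simpa using ⟨j, le_rfl, rfl⟩⟩)
      rcases u' with n' | ⟨r', a', j''⟩
      · exact absurd h2 (by simp)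
      · rw [inl_mem_virtual_inr] at h1
        obtain ⟨rfl, i, hi, hi'⟩ := inr_mem_virtual_inr.mp h2
        obtain rfl := hx _ h1.1
        obtain rfl := opp_injective _ hi'
        have : i ≤ j'' := by
          have := h1.2
          rw [Fin.lt_def] at this
          rw [Fin.le_def]
          simp only [hj'] at this
          omega
        rw [le_antisymm this hi]

theorem height_injOn_simplex (t : R ⊕ R × Fin 3 × Fin (k + 3)) :
    Set.InjOn height (simplex (k := k) x t : Set (Vertex N R k)) := by
  intro v hv w hw h
  rw [mem_coe] at hv hw
  rcases t with r | ⟨r, a, j⟩ <;> rcases v with ⟨n, i⟩ | ⟨r', i⟩ <;>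
    rcases w with ⟨n', i'⟩ | ⟨r'', i'⟩ <;>
    simp only [inl_mem_simplex_inl, inr_mem_simplex_inl, inl_mem_simplex_inr,
      inr_mem_simplex_inr, height] at hv hw h
  · rw [hv, hw, Fin.ext (by omega : (i : ℕ) = i')]
  · rw [hv.1, hw.1, Fin.ext (by omega : (i : ℕ) = i')]
  · omega
  · omega
  · rw [hv.1, hw.1, Fin.ext (by omega : (i : ℕ) = i')]

theorem height_injOn_virtual (u : N ⊕ R × Fin 3 × Fin (k + 3)) :
    Set.InjOn height (virtual (k := k) x u : Set (Vertex N R k)) := by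
  intro v hv w hw h
  rw [mem_coe] at hv hw
  rcases u with n | ⟨r, a, j⟩ <;> rcases v with ⟨n', i⟩ | ⟨r', i⟩ <;>
    rcases w with ⟨n', i'⟩ | ⟨r'', i'⟩ <;>
    simp only [inl_mem_virtual_inl, inr_mem_virtual_inl, inl_mem_virtual_inr,
      inr_mem_virtual_inr, height] at hv hw h
  · rw [hv, hw, Fin.ext (by omega : (i : ℕ) = i')]
  · rw [hv.1, hw.1, Fin.ext (by omega : (i : ℕ) = i')]
  · omega
  · omega
  · rw [hv.1, hw.1, Fin.ext (by omega : (i : ℕ) = i')]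

/-- The next slice of the cylinder. -/
def next (x : R → Fin 3 → N) (r : R) (a : Fin 3) (j : Fin (k + 3)) :
    N ⊕ R × Fin 3 × Fin (k + 3) :=
  if h : (j : ℕ) + 1 < k + 3 then Sum.inr (r, a, ⟨j + 1, h⟩) else Sum.inl (x r a)

/-- With `virtual_next_eq_erase`: the special facets of a cylinder simplex are two consecutive
slices, the generator simplex following the last slice. -/
theorem virtual_eq_erase (r : R) (a : Fin 3) (j : Fin (k + 3)) :
    virtual (k := k) x (Sum.inr (r, a, j)) =
      (simplex x (Sum.inr (r, a, j))).erase (Sum.inl (x r a, j)) := by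
  ext v
  rcases v with ⟨n, i⟩ | ⟨r', i⟩
  · simp only [inl_mem_virtual_inr, mem_erase, ne_eq, Sum.inl.injEq, Prod.mk.injEq,
      inl_mem_simplex_inr, lt_iff_le_and_ne]
    tauto
  · simp

theorem virtual_next_eq_erase (r : R) (a : Fin 3) (j : Fin (k + 3)) :
    virtual (k := k) x (next x r a j) =
      (simplex x (Sum.inr (r, a, j))).erase (Sum.inr (r, opp a j)) := by
  unfold next
  ext v
  split_ifs with h
  · rcases v with ⟨n, i⟩ | ⟨r', i⟩
    · simp only [inl_mem_virtual_inr, mem_erase, ne_eq, reduceCtorEq, not_false_eq_true,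
        inl_mem_simplex_inr, true_and, Fin.lt_def, Fin.le_def, Nat.lt_succ_iff]
    · simp only [inr_mem_virtual_inr, mem_erase, ne_eq, Sum.inr.injEq, Prod.mk.injEq, not_and,
        inr_mem_simplex_inr]
      constructor
      · rintro ⟨rfl, i', hi', rfl⟩
        rw [Fin.le_def] at hi'
        refine ⟨fun _ h => ?_, rfl, i', Fin.le_def.mpr (by simp at hi'; omega), rfl⟩
        have := opp_injective _ h
        subst this
        simp at hi'
      · rintro ⟨h, rfl, i', hi', rfl⟩
        refine ⟨rfl, i', ?_, rfl⟩
        have h1 : (i' : ℕ) ≠ j := fun e => h rfl (by rw [Fin.ext e])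
        rw [Fin.le_def] at hi' ⊢
        simp only
        omega
  · rcases v with ⟨n, i⟩ | ⟨r', i⟩
    · simp only [inl_mem_virtual_inl, mem_erase, ne_eq, reduceCtorEq, not_false_eq_true,
        inl_mem_simplex_inr, true_and]
      exact ⟨fun e => ⟨e, Fin.le_def.mpr (by omega)⟩, fun e => e.1⟩
    · simp only [inr_mem_virtual_inl, mem_erase, ne_eq, Sum.inr.injEq, Prod.mk.injEq, not_and,
        inr_mem_simplex_inr, false_iff]
      rintro h' rfl ⟨i', hi', rfl⟩
      refine h' rfl ?_
      rw [Fin.le_def] at hi'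
      rw [Fin.ext (by omega : (i' : ℕ) = j)]

/-- This glues the cylinder to the relation simplex. -/
theorem virtual_zero_eq_erase (r : R) (a : Fin 3) :
    virtual (k := k) x (Sum.inr (r, a, 0)) =
      (simplex x (Sum.inl r)).erase (Sum.inr (r, a.castLE (by omega))) := by
  ext v
  rcases v with ⟨n, i⟩ | ⟨r', i⟩
  · simp
  · simp only [inr_mem_virtual_inr, Fin.zero_le, true_and, mem_erase, ne_eq, Sum.inr.injEq,
      Prod.mk.injEq, not_and, inr_mem_simplex_inl]
    constructor
    · rintro ⟨rfl, i', rfl⟩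
      exact ⟨fun _ => opp_ne_castLE _ _, rfl⟩
    · rintro ⟨h, rfl⟩
      exact ⟨rfl, Fin.exists_succAbove_eq (h rfl)⟩

end Gadget

end

/-! ### Colored gadgets and the group they present. -/

noncomputable section

open Finset AbstractSimplicialComplex

theorem Finset.image_erase_of_injOn {α β : Type*} [DecidableEq α] [DecidableEq β] {f : α → β}
    {s : Finset α} (hf : Set.InjOn f s) {a : α} (ha : a ∈ s) :
    (s.erase a).image f = (s.image f).erase (f a) := by
  ext b
  simp only [mem_image, mem_erase]
  constructor
  · rintro ⟨c, ⟨hca, hc⟩, rfl⟩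
    exact ⟨fun h => hca (hf hc ha h), c, hc, rfl⟩
  · rintro ⟨hb, c, hc, rfl⟩
    exact ⟨c, ⟨fun h => hb (h ▸ rfl), hc⟩, rfl⟩

namespace Gadget

variable {N R : Type*} {k : ℕ}

/-- The generator whose simplex is homologous to a virtual facet. -/
def label (x : R → Fin 3 → N) : N ⊕ R × Fin 3 × Fin (k + 3) → N :=
  Sum.elim id fun p => x p.1 p.2.1

/-- The relation with three terms. -/
def ternaryRelation (x : R → Fin 3 → N) (r : R) : N →₀ ℤ :=
  Finsupp.single (x r 0) 1 - Finsupp.single (x r 1) 1 + Finsupp.single (x r 2) 1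

theorem label_next (x : R → Fin 3 → N) (r : R) (a : Fin 3) (j : Fin (k + 3)) : label x (next x r a j) = x r a := by
  unfold next
  split_ifs <;> rfl

variable [DecidableEq N] [DecidableEq R] (x : R → Fin 3 → N) {W : Type*} [LinearOrder W]

/-- The sets of vertices contained in a simplex or a virtual facet. -/
def IsFace (s : Finset (Vertex N R k)) : Prop :=
  (∃ t, s ⊆ simplex x t) ∨ ∃ u, s ⊆ virtual x u

variable {x} in
theorem IsFace.mono {s s' : Finset (Vertex N R k)} (h : IsFace x s) (hs : s' ⊆ s) : IsFace x s' :=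
  h.imp (fun ⟨t, ht⟩ => ⟨t, hs.trans ht⟩) fun ⟨u, hu⟩ => ⟨u, hs.trans hu⟩

theorem isFace_simplex (t : R ⊕ R × Fin 3 × Fin (k + 3)) : IsFace (k := k) x (simplex x t) :=
  Or.inl ⟨t, Subset.rfl⟩

theorem isFace_virtual (u : N ⊕ R × Fin 3 × Fin (k + 3)) : IsFace (k := k) x (virtual x u) :=
  Or.inr ⟨u, Subset.rfl⟩

/-- An order preserving coloring that distinguishes the faces with `k + 2` vertices. -/
structure IsGoodColoring (c : Vertex N R k → W) : Prop where
  lt_of_height_lt : ∀ v w, height v < height w → c v < c w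
  eq_of_image_eq : ∀ s s', IsFace x s → IsFace x s' → #s = k + 2 → s.image c = s'.image c → s = s'

namespace IsGoodColoring

variable {x} {c : Vertex N R k → W}

theorem injOn_of_height (hc : IsGoodColoring x c) {s : Set (Vertex N R k)} (hs : Set.InjOn height s) :
    Set.InjOn c s := by
  intro v hv w hw h
  refine hs hv hw ?_
  rcases lt_trichotomy (height v) (height w) with h' | h' | h'
  · exact absurd h (hc.lt_of_height_lt _ _ h').ne
  · exact h'
  · exact absurd h (hc.lt_of_height_lt _ _ h').ne'

theorem injOn_simplex (hc : IsGoodColoring x c) (t : R ⊕ R × Fin 3 × Fin (k + 3)) :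
    Set.InjOn c (simplex (k := k) x t : Set (Vertex N R k)) :=
  hc.injOn_of_height (height_injOn_simplex t)

theorem injOn_virtual (hc : IsGoodColoring x c) (u : N ⊕ R × Fin 3 × Fin (k + 3)) :
    Set.InjOn c (virtual (k := k) x u : Set (Vertex N R k)) :=
  hc.injOn_of_height (height_injOn_virtual u)

theorem subset_of_image_subset (hc : IsGoodColoring x c) {s s' : Finset (Vertex N R k)}
    (hs : IsFace x s)
    (hs' : IsFace x s') (h : #s = k + 2) (hss : s.image c ⊆ s'.image c) : s ⊆ s' := by
  obtain ⟨s'', hsub, him⟩ := subset_image_iff.mp hss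
  rw [hc.eq_of_image_eq s s'' hs (hs'.mono (by exact_mod_cast hsub)) h him.symm]
  exact_mod_cast hsub

/-- A set of `k + 2` colors of vertices of a simplex that contains the colors of the special
vertices comes from a set of vertices. -/
theorem exists_of_image_special_subset (hc : IsGoodColoring x c)
    {t : R ⊕ R × Fin 3 × Fin (k + 3)} {ρ : Finset W}
    (hρ : #ρ = k + 2) (hA : (special x t).image c ⊆ ρ) (hρt : ρ ⊆ (simplex x t).image c) :
    ∃ s, IsFace x s ∧ #s = k + 2 ∧ s.image c = ρ ∧ special x t ⊆ s := by
  obtain ⟨s, hsub, rfl⟩ := subset_image_iff.mp hρt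
  have hsub' : s ⊆ simplex x t := by exact_mod_cast hsub
  refine ⟨s, (isFace_simplex x t).mono hsub', ?_, rfl, ?_⟩
  · rwa [card_image_of_injOn ((hc.injOn_simplex t).mono hsub)] at hρ
  · intro a ha
    obtain ⟨b, hb, hba⟩ := mem_image.mp (hA (mem_image_of_mem c ha))
    rwa [← hc.injOn_simplex t (hsub hb) (special_subset x t ha) hba]

end IsGoodColoring

/-- The relation between the virtual facets of a simplex. -/
def relation (c : Vertex N R k → W) :
    R ⊕ R × Fin 3 × Fin (k + 3) → N ⊕ R × Fin 3 × Fin (k + 3) →₀ ℤ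
  | Sum.inl r => vertexSign ((simplex x (Sum.inl r)).image c) (c (Sum.inr (r, 0))) •
      (Finsupp.single (Sum.inr (r, 0, 0)) 1 - Finsupp.single (Sum.inr (r, 1, 0)) 1 +
        Finsupp.single (Sum.inr (r, 2, 0)) 1)
  | Sum.inr (r, a, j) =>
      vertexSign ((simplex x (Sum.inr (r, a, j))).image c) (c (Sum.inl (x r a, j))) •
        (Finsupp.single (Sum.inr (r, a, j)) 1 - Finsupp.single (next x r a j) 1)

variable {x}

/-- The color order refines the height order, so neighbors in height stay neighbors after coloring.
-/
theorem vertexSign_image_eq_neg {c : Vertex N R k → W} (hc : IsGoodColoring x c)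
    {s : Finset (Vertex N R k)} (hs : Set.InjOn height (s : Set (Vertex N R k)))
    {v w : Vertex N R k} (hv : v ∈ s) (hw : w ∈ s) (hvw : height v < height w)
    (h : ∀ y ∈ s, height v < height y → height w ≤ height y) :
    vertexSign (s.image c) (c w) = -vertexSign (s.image c) (c v) := by
  refine vertexSign_eq_neg_of_covBy (mem_image_of_mem c hv) (hc.lt_of_height_lt _ _ hvw) ?_
  intro a ha hva
  obtain ⟨y, hy, rfl⟩ := mem_image.mp ha
  have hvy : height v < height y := by
    by_contra! h'
    rcases h'.lt_or_eq with h' | h'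
    · exact lt_asymm hva (hc.lt_of_height_lt _ _ h')
    · rw [hs hy hv h'] at hva
      exact lt_irrefl _ hva
  rcases (h y hy hvy).lt_or_eq with h' | h'
  · exact (hc.lt_of_height_lt _ _ h').le
  · rw [hs hw hy h']

/-- The special vertices are consecutive in height, so their signs alternate: this gives the pattern
`+ - +` on a relation simplex and `+ -` on a cylinder simplex, up to the global sign in `relation`.
-/
theorem mapDomain_relation {c : Vertex N R k → W} (hc : IsGoodColoring x c)
    (t : R ⊕ R × Fin 3 × Fin (k + 3)) :
    Finsupp.mapDomain (fun u => (virtual x u).image c) (relation x c t) =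
      ∑ a ∈ (special x t).image c, Finsupp.single (((simplex x t).image c).erase a)
        (vertexSign ((simplex x t).image c) a) := by
  rw [sum_image (fun a ha b hb h => hc.injOn_simplex t (special_subset x t ha)
    (special_subset x t hb) h)]
  rcases t with r | ⟨r, a, j⟩
  · have h1 : ∀ a : Fin 3, (Sum.inr (r, a.castLE (by omega)) : Vertex N R k) ∈
        simplex x (Sum.inl r) := fun a => by simp
    have hs : ∀ a b : Fin 3, (b : ℕ) = a + 1 →
        vertexSign ((simplex x (Sum.inl r)).image c)
          (c (Sum.inr (r, b.castLE (by omega)) : Vertex N R k)) =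
        -vertexSign ((simplex x (Sum.inl r)).image c)
          (c (Sum.inr (r, a.castLE (by omega)) : Vertex N R k)) := by
      intro a b hab
      refine vertexSign_image_eq_neg hc (height_injOn_simplex _) (h1 a) (h1 b) ?_ ?_
      · simp only [height, Fin.val_castLE]; omega
      · rintro (y | ⟨r', i⟩) hy
        · simp at hy
        · simp only [height, Fin.val_castLE]; omega
    have h0 : (0 : Fin (k + 4)) = (0 : Fin 3).castLE (by omega) := rfl
    rw [special, sum_image (fun a _ b _ h => by simpa using h), Fin.sum_univ_three,
      hs 1 2 rfl, hs 0 1 rfl, ← image_erase_of_injOn (hc.injOn_simplex _) (h1 0),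
      ← image_erase_of_injOn (hc.injOn_simplex _) (h1 1),
      ← image_erase_of_injOn (hc.injOn_simplex _) (h1 2), ← virtual_zero_eq_erase,
      ← virtual_zero_eq_erase, ← virtual_zero_eq_erase, relation, h0]
    simp only [← Finsupp.lmapDomain_apply (R := ℤ) (M := ℤ), map_smul, map_add, map_sub]
    simp only [Finsupp.lmapDomain_apply, Finsupp.mapDomain_single, smul_add, smul_sub,
      Finsupp.smul_single, smul_eq_mul, mul_one, neg_neg, Finsupp.single_neg]
    abel
  · have h1 : (Sum.inl (x r a, j) : Vertex N R k) ∈ simplex x (Sum.inr (r, a, j)) := by simp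
    have h2 : (Sum.inr (r, opp a j) : Vertex N R k) ∈ simplex x (Sum.inr (r, a, j)) :=
      inr_mem_simplex_inr.mpr ⟨rfl, j, le_rfl, rfl⟩
    have hs := vertexSign_image_eq_neg hc (height_injOn_simplex _) h1 h2
      (by simp only [height]; omega) (by
        rintro (⟨n, i⟩ | ⟨r', i⟩) hy hlt
        · rw [inl_mem_simplex_inr, Fin.le_def] at hy
          simp only [height] at hlt
          omega
        · obtain ⟨-, i', hi, rfl⟩ := inr_mem_simplex_inr.mp hy
          rw [Fin.le_def] at hi
          simp only [height, opp_val]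
          split_ifs <;> omega)
    rw [special, sum_pair (by simp), hs, ← image_erase_of_injOn (hc.injOn_simplex _) h1,
      ← image_erase_of_injOn (hc.injOn_simplex _) h2, ← virtual_eq_erase,
      ← virtual_next_eq_erase, relation]
    simp only [← Finsupp.lmapDomain_apply (R := ℤ) (M := ℤ), map_smul, map_sub]
    simp only [Finsupp.lmapDomain_apply, Finsupp.mapDomain_single, smul_sub,
      Finsupp.smul_single, smul_eq_mul, mul_one, Finsupp.single_neg]
    abel

/-- The colored simplices realizing a presentation. -/
def system (hx : ∀ r, Function.Injective (x r)) {c : Vertex N R k → W}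
    (hc : IsGoodColoring x c) :
    SimplexSystem W (R ⊕ R × Fin 3 × Fin (k + 3)) (N ⊕ R × Fin 3 × Fin (k + 3)) k where
  τ t := (simplex x t).image c
  A t := (special x t).image c
  σ u := (virtual x u).image c
  rel := relation x c
  A_subset t := image_subset_image (special_subset x t)
  exists_notMem t := by
    refine exists_mem_notMem_of_card_lt_card ?_
    rw [card_image_of_injOn (hc.injOn_simplex t), card_simplex]
    have := (card_image_le (s := special x t) (f := c)).trans (card_special_le x t)
    omega
  card_τ t := by rw [card_image_of_injOn (hc.injOn_simplex t), card_simplex]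
  card_σ u := by rw [card_image_of_injOn (hc.injOn_virtual u), card_virtual]
  mapDomain_rel := mapDomain_relation hc
  eq_of_subset t t' ρ hρ hA hρt hρt' := by
    obtain ⟨s, hs, hcard, rfl, hAs⟩ := hc.exists_of_image_special_subset hρ hA hρt
    exact eq_of_special_subset_simplex hx
      (hAs.trans (hc.subset_of_image_subset hs (isFace_simplex x t') hcard hρt'))
  not_subset t u ρ hρ hA hρt hρu := by
    obtain ⟨s, hs, hcard, rfl, hAs⟩ := hc.exists_of_image_special_subset hρ hA hρt
    exact not_special_subset_virtual hx
      (hAs.trans (hc.subset_of_image_subset hs (isFace_virtual x u) hcard hρu))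
  exists_ridge u := by
    obtain ⟨v, hv, h⟩ := exists_ridge_virtual hx u
    refine ⟨c v, mem_image_of_mem c hv, fun u' hu' => h u' ?_⟩
    rw [← image_erase_of_injOn (hc.injOn_virtual u) hv] at hu'
    refine hc.subset_of_image_subset ((isFace_virtual x u).mono (erase_subset _ _))
      (isFace_virtual x u') ?_ hu'
    rw [card_erase_of_mem hv, card_virtual]
    rfl

theorem mem_of_sign_smul_mem {M : Type*} [AddCommGroup M] {P : Submodule ℤ M} {s : Finset W}
    {w : W} {m : M} (h : vertexSign s w • m ∈ P) : m ∈ P := by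
  have := P.smul_mem (vertexSign s w) h
  rwa [smul_smul, vertexSign_mul_self, one_smul] at this

/-- The cylinder relations telescope: each slice equals the next one, and the last equals the
generator simplex. -/
theorem single_sub_single_mem_span (c : Vertex N R k → W) (u : N ⊕ R × Fin 3 × Fin (k + 3)) :
    Finsupp.single u 1 - Finsupp.single (Sum.inl (label x u)) 1 ∈
      Submodule.span ℤ (Set.range (relation x c)) := by
  rcases u with n | ⟨r, a, j⟩
  · simp [label]
  · obtain ⟨m, hm⟩ : ∃ m, (j : ℕ) + m = k + 2 := ⟨k + 2 - j, by omega⟩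
    induction m generalizing j with
    | zero =>
      have h := mem_of_sign_smul_mem
        (Submodule.subset_span ⟨Sum.inr (r, a, j), rfl⟩ :
          relation x c (Sum.inr (r, a, j)) ∈ Submodule.span ℤ (Set.range (relation x c)))
      rw [next, dif_neg (by omega)] at h
      exact h
    | succ m ih =>
      have h := mem_of_sign_smul_mem
        (Submodule.subset_span ⟨Sum.inr (r, a, j), rfl⟩ :
          relation x c (Sum.inr (r, a, j)) ∈ Submodule.span ℤ (Set.range (relation x c)))
      rw [next, dif_pos (by omega)] at h
      have h2 := add_mem h (ih ⟨j + 1, by omega⟩ (by simp; omega))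
      rw [sub_add_sub_cancel] at h2
      exact h2

/-- A Tietze reduction: the cylinder relations eliminate the slices, and the relation of a relation
simplex turns into the ternary relation of its labels. -/
theorem ker_comp_label {M : Type*} [AddCommGroup M] (c : Vertex N R k → W)
    (Λ : (N →₀ ℤ) →ₗ[ℤ] M)
    (hker : LinearMap.ker Λ = Submodule.span ℤ (Set.range (ternaryRelation x))) :
    LinearMap.ker (Λ ∘ₗ Finsupp.lmapDomain ℤ ℤ (label (k := k) x)) =
      Submodule.span ℤ (Set.range (relation x c)) := by
  refine le_antisymm ?_ (Submodule.span_le.mpr ?_)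
  · set P := Submodule.span ℤ (Set.range (relation x c)) with hP
    have h1 : ∀ e : N ⊕ R × Fin 3 × Fin (k + 3) →₀ ℤ,
        e - Finsupp.mapDomain Sum.inl (Finsupp.mapDomain (label x) e) ∈ P := by
      intro e
      have h : P.mkQ ∘ₗ (LinearMap.id - Finsupp.lmapDomain ℤ ℤ Sum.inl ∘ₗ
          Finsupp.lmapDomain ℤ ℤ (label x)) = 0 := by
        refine Finsupp.lhom_ext' fun u => LinearMap.ext_ring ?_
        simp only [LinearMap.comp_apply, Finsupp.lsingle_apply, LinearMap.sub_apply,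
          LinearMap.id_apply, Finsupp.lmapDomain_apply, Finsupp.mapDomain_single,
          LinearMap.zero_apply, Submodule.mkQ_apply, Submodule.Quotient.mk_eq_zero]
        exact single_sub_single_mem_span c u
      exact (Submodule.Quotient.mk_eq_zero P).mp (LinearMap.congr_fun h e)
    have h2 : Submodule.span ℤ (Set.range (ternaryRelation x)) ≤
        P.comap (Finsupp.lmapDomain ℤ ℤ Sum.inl) := by
      rw [Submodule.span_le]
      rintro _ ⟨r, rfl⟩
      have hr := mem_of_sign_smul_mem
        (Submodule.subset_span ⟨Sum.inl r, rfl⟩ : relation x c (Sum.inl r) ∈ P)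
      have := sub_mem hr (h1 (Finsupp.single (Sum.inr (r, 0, 0)) 1 -
        Finsupp.single (Sum.inr (r, 1, 0)) 1 + Finsupp.single (Sum.inr (r, 2, 0)) 1))
      rw [sub_sub_cancel] at this
      simp only [← Finsupp.lmapDomain_apply (R := ℤ) (M := ℤ), map_add, map_sub] at this
      simp only [SetLike.mem_coe, Submodule.mem_comap, ternaryRelation, map_add, map_sub]
      simpa [label] using this
    intro e he
    have h3 := h2 (hker ▸ (show Finsupp.mapDomain (label x) e ∈ LinearMap.ker Λ from he))
    have := add_mem (h1 e) h3
    simpa using this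
  · rintro _ ⟨r | ⟨r, a, j⟩, rfl⟩
    · have : ternaryRelation x r ∈ LinearMap.ker Λ := hker ▸ Submodule.subset_span ⟨r, rfl⟩
      rw [LinearMap.mem_ker, ternaryRelation] at this
      simp only [SetLike.mem_coe, LinearMap.mem_ker, relation, map_smul, LinearMap.comp_apply,
        map_add, map_sub, Finsupp.lmapDomain_apply, Finsupp.mapDomain_single]
      simp only [map_add, map_sub] at this
      rw [show Λ (Finsupp.single (label x (Sum.inr (r, 0, (0 : Fin (k + 3))))) 1) -
        Λ (Finsupp.single (label x (Sum.inr (r, 1, (0 : Fin (k + 3))))) 1) +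
        Λ (Finsupp.single (label x (Sum.inr (r, 2, (0 : Fin (k + 3))))) 1) = 0 from this,
        smul_zero]
    · simp only [SetLike.mem_coe, LinearMap.mem_ker, relation, map_smul, LinearMap.comp_apply,
        map_sub, Finsupp.lmapDomain_apply, Finsupp.mapDomain_single, label_next]
      rw [show label x (Sum.inr (r, a, j)) = x r a from rfl, sub_self, smul_zero]

theorem exists_torsion_addEquiv_of_isGoodColoring {M : Type*} [AddCommGroup M]
    (hx : ∀ r, Function.Injective (x r)) {c : Vertex N R k → W} (hc : IsGoodColoring x c)
    (Λ : (N →₀ ℤ) →ₗ[ℤ] M) (hΛ : Function.Surjective Λ)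
    (hker : LinearMap.ker Λ = Submodule.span ℤ (Set.range (ternaryRelation x))) :
    ∃ X : AbstractSimplicialComplex W,
      Nonempty (AddCommGroup.torsion (X.Homology (k + 1)) ≃+ AddCommGroup.torsion M) := by
  refine ⟨(system hx hc).complex, (system hx hc).nonempty_torsion_homology_complex_addEquiv
    (Λ ∘ₗ Finsupp.lmapDomain ℤ ℤ (label x)) ?_ (ker_comp_label c Λ hker)⟩
  refine hΛ.comp ?_
  intro e
  refine ⟨Finsupp.mapDomain Sum.inl e, ?_⟩
  rw [Finsupp.lmapDomain_apply, ← Finsupp.mapDomain_comp]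
  exact Finsupp.mapDomain_id

/-! ### Colorings with few colors -/

variable [Fintype R]

theorem card_filter_mem_simplex_le {B : ℕ} (hB : ∀ n, #{p : R × Fin 3 | x p.1 p.2 = n} ≤ B)
    (v : Vertex N R k) : #{t | v ∈ simplex x t} ≤ (B + 3) * (k + 3) + 1 := by
  rcases v with ⟨n, i⟩ | ⟨r, i⟩
  · have : ({t | Sum.inl (n, i) ∈ simplex (k := k) x t} : Finset _) ⊆
        (({p : R × Fin 3 | x p.1 p.2 = n} : Finset _) ×ˢ (univ : Finset (Fin (k + 3)))).image
          fun p => Sum.inr (p.1.1, p.1.2, p.2) := by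
      rintro (r | ⟨r, a, j⟩) ht
      · simp at ht
      · simp only [mem_filter, mem_univ, true_and, inl_mem_simplex_inr] at ht
        exact mem_image.mpr ⟨((r, a), j), by simp [ht.1], rfl⟩
    refine (card_le_card this).trans (card_image_le.trans ?_)
    rw [card_product, card_univ, Fintype.card_fin]
    nlinarith [hB n]
  · have : ({t | Sum.inr (r, i) ∈ simplex (k := k) x t} : Finset _) ⊆
        insert (Sum.inl r) ((univ : Finset (Fin 3 × Fin (k + 3))).image
          fun p => Sum.inr (r, p.1, p.2)) := by
      rintro (r' | ⟨r', a, j⟩) ht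
      · simp only [mem_filter, mem_univ, true_and, inr_mem_simplex_inl] at ht
        simp [ht]
      · simp only [mem_filter, mem_univ, true_and, inr_mem_simplex_inr] at ht
        simp [ht.1]
    refine (card_le_card this).trans ((card_insert_le _ _).trans
      (Nat.add_le_add_right (card_image_le.trans ?_) 1))
    rw [card_univ, Fintype.card_prod, Fintype.card_fin, Fintype.card_fin]
    nlinarith

variable [Fintype N]

variable (k x) in
/-- All faces. -/
def faces : Finset (Finset (Vertex N R k)) :=
  (univ.biUnion fun t => (simplex x t).powerset) ∪ univ.biUnion fun u => (virtual x u).powerset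

theorem mem_faces {s : Finset (Vertex N R k)} : s ∈ faces k x ↔ IsFace x s := by
  simp [faces, IsFace]

theorem card_filter_mem_virtual_le {B : ℕ} (hB : ∀ n, #{p : R × Fin 3 | x p.1 p.2 = n} ≤ B)
    (v : Vertex N R k) : #{u | v ∈ virtual x u} ≤ (B + 3) * (k + 3) + 1 := by
  rcases v with ⟨n, i⟩ | ⟨r, i⟩
  · have : ({u | Sum.inl (n, i) ∈ virtual (k := k) x u} : Finset _) ⊆
        insert (Sum.inl n) ((({p : R × Fin 3 | x p.1 p.2 = n} : Finset _) ×ˢ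
          (univ : Finset (Fin (k + 3)))).image fun p => Sum.inr (p.1.1, p.1.2, p.2)) := by
      rintro (n' | ⟨r, a, j⟩) ht
      · simp only [mem_filter, mem_univ, true_and, inl_mem_virtual_inl] at ht
        simp [ht]
      · simp only [mem_filter, mem_univ, true_and, inl_mem_virtual_inr] at ht
        exact mem_insert_of_mem (mem_image.mpr ⟨((r, a), j), by simp [ht.1], rfl⟩)
    refine (card_le_card this).trans ((card_insert_le _ _).trans
      (Nat.add_le_add_right (card_image_le.trans ?_) 1))
    rw [card_product, card_univ, Fintype.card_fin]
    nlinarith [hB n]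
  · have : ({u | Sum.inr (r, i) ∈ virtual (k := k) x u} : Finset _) ⊆
        (univ : Finset (Fin 3 × Fin (k + 3))).image fun p => Sum.inr (r, p.1, p.2) := by
      rintro (n | ⟨r', a, j⟩) ht
      · simp at ht
      · simp only [mem_filter, mem_univ, true_and, inr_mem_virtual_inr] at ht
        simp [ht.1]
    refine (card_le_card this).trans (card_image_le.trans ?_)
    rw [card_univ, Fintype.card_prod, Fintype.card_fin, Fintype.card_fin]
    nlinarith

theorem card_faces_mem_le {B : ℕ} (hB : ∀ n, #{p : R × Fin 3 | x p.1 p.2 = n} ≤ B)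
    (v : Vertex N R k) :
    #{F ∈ faces k x | v ∈ F} ≤ ((B + 3) * (k + 3) + 1) * 2 ^ (k + 5) := by
  have hsub : {F ∈ faces k x | v ∈ F} ⊆
      (({t | v ∈ simplex x t} : Finset _).biUnion fun t => (simplex x t).powerset) ∪
      ({u | v ∈ virtual x u} : Finset _).biUnion fun u => (virtual x u).powerset := by
    intro F hF
    simp only [mem_filter, faces, mem_union, mem_biUnion, mem_univ, true_and, mem_powerset] at hF ⊢
    exact hF.1.imp (fun ⟨t, ht⟩ => ⟨t, ht hF.2, ht⟩) fun ⟨u, hu⟩ => ⟨u, hu hF.2, hu⟩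
  refine (card_le_card hsub).trans ((card_union_le _ _).trans ?_)
  have h1 : #(({t | v ∈ simplex x t} : Finset _).biUnion fun t => (simplex x t).powerset) ≤
      ((B + 3) * (k + 3) + 1) * 2 ^ (k + 4) :=
    (card_biUnion_le_card_mul _ _ (2 ^ (k + 4)) fun t _ => by rw [card_powerset, card_simplex]).trans
      (Nat.mul_le_mul_right _ (card_filter_mem_simplex_le hB v))
  have h2 : #(({u | v ∈ virtual x u} : Finset _).biUnion fun u => (virtual x u).powerset) ≤
      ((B + 3) * (k + 3) + 1) * 2 ^ (k + 4) :=
    (card_biUnion_le_card_mul _ _ (2 ^ (k + 4)) fun t _ => by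
      rw [card_powerset, card_virtual]
      exact Nat.pow_le_pow_right (by norm_num) (by omega)).trans
      (Nat.mul_le_mul_right _ (card_filter_mem_virtual_le hB v))
  rw [pow_succ 2 (k + 4)]
  linarith

/-- A presentation with `n` generators and relations in which every generator is used boundedly
often is realized by a complex with `O(n ^ (1 / (k + 2)))` vertices. -/
theorem exists_complex_of_presentation (k B : ℕ) : ∃ C : ℕ, ∀ {N R M : Type} [Fintype N]
    [Fintype R] [DecidableEq N] [DecidableEq R] [AddCommGroup M] (x : R → Fin 3 → N),
    (∀ r, Function.Injective (x r)) → (∀ n, #{p : R × Fin 3 | x p.1 p.2 = n} ≤ B) →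
    ∀ Λ : (N →₀ ℤ) →ₗ[ℤ] M, Function.Surjective Λ →
    LinearMap.ker Λ = Submodule.span ℤ (Set.range (ternaryRelation x)) →
    ∀ q, 1 ≤ q → (k + 4) * (Fintype.card N + Fintype.card R) ≤ q ^ (k + 2) →
    ∃ X : AbstractSimplicialComplex (Fin (C * q)),
      Nonempty (AddCommGroup.torsion (X.Homology (k + 1)) ≃+ AddCommGroup.torsion M) := by
  -- A vertex lies in at most `(B + 3) * (k + 3) + 1` simplices and in at most as many virtual
  -- facets, each having at most `2 ^ (k + 4)` subsets.
  set Δ := ((B + 3) * (k + 3) + 1) * 2 ^ (k + 5) with hΔ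
  set K₀ := Δ * ((k + 4) * (Δ * (k + 4))) + Δ * Δ + 1 with hK₀
  refine ⟨(2 * k + 7) * K₀, fun {N R M} _ _ _ _ _ x hx hB Λ hΛ hker q hq hcard => ?_⟩
  have hK : Δ * ((k + 4) * (Δ * (k + 4))) + Δ * (Δ * q) < K₀ * q := by
    have : Δ * ((k + 4) * (Δ * (k + 4))) ≤ Δ * ((k + 4) * (Δ * (k + 4))) * q :=
      Nat.le_mul_of_pos_right _ hq
    rw [hK₀]
    linarith
  have hΔ1 : 1 ≤ Δ := Nat.mul_pos (Nat.succ_pos _) (Nat.pow_pos (by norm_num))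
  have hV : Fintype.card (Vertex N R k) ≤ q ^ (k + 2) := by
    refine le_trans ?_ hcard
    rw [Fintype.card_sum, Fintype.card_prod, Fintype.card_prod, Fintype.card_fin, Fintype.card_fin]
    nlinarith
  obtain ⟨col, hinj, hcol⟩ := exists_coloring (𝓕 := faces k x) (m := k + 4)
    (fun F hF F' hF' => mem_faces.mpr ((mem_faces.mp hF).mono hF')) (card_faces_mem_le hB)
    (fun F hF => by
      rcases mem_faces.mp hF with ⟨t, ht⟩ | ⟨u, hu⟩
      · exact (card_le_card ht).trans (card_simplex x t).le
      · exact (card_le_card hu).trans ((card_virtual x u).le.trans (by omega)))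
    hΔ1 hq hV hK
  have hlt : ∀ v : Vertex N R k, height v * (K₀ * q) + col v < (2 * k + 7) * K₀ * q := by
    intro v
    have h1 := (col v).2
    have h2 : (height v + 1) * (K₀ * q) ≤ (2 * k + 7) * (K₀ * q) :=
      Nat.mul_le_mul_right _ (height_lt v)
    rw [mul_assoc]
    linarith
  -- The leading digit makes the color order follow the height; the remainder modulo `K₀ * q`
  -- recovers the separating coloring.
  set c : Vertex N R k → Fin ((2 * k + 7) * K₀ * q) :=
    fun v => ⟨height v * (K₀ * q) + col v, hlt v⟩ with hc
  have hmod : ∀ v, c v % (K₀ * q) = col v := fun v => by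
    change (height v * (K₀ * q) + col v) % (K₀ * q) = col v
    rw [Nat.mul_add_mod_of_lt (col v).2]
  have hgood : IsGoodColoring x c := by
    refine ⟨fun v w h => ?_, fun s s' hs hs' hsc h => ?_⟩
    · rw [Fin.lt_def]
      change height v * (K₀ * q) + col v < height w * (K₀ * q) + col w
      have h1 := (col v).2
      have h2 : (height v + 1) * (K₀ * q) ≤ height w * (K₀ * q) := Nat.mul_le_mul_right _ h
      linarith
    · refine hcol s (mem_faces.mpr hs) s' (mem_faces.mpr hs') hsc ?_
      have h' := congrArg (Finset.image fun a : Fin ((2 * k + 7) * K₀ * q) =>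
        (a : ℕ) % (K₀ * q)) h
      rw [image_image, image_image] at h'
      have h'' : (s.image col).image Fin.val = (s'.image col).image Fin.val := by
        rw [image_image, image_image]
        convert h' using 2 <;> exact funext fun v => (hmod v).symm
      exact image_injective Fin.val_injective h''
  exact exists_torsion_addEquiv_of_isGoodColoring hx hgood Λ hΛ hker

end Gadget

end

/-! ### Presentations of logarithmic size with three-term relations. -/

noncomputable section

open Finset DirectSum

/-- Bijective binary expansions, with the digits `1` and `2`. -/
theorem exists_bijective_binary (m : ℕ) : ∃ (n : ℕ) (δ : ℕ → Bool),
    ∑ l ∈ range n, (if δ l then 2 else 1) * 2 ^ l = m ∧ 2 ^ n ≤ m + 1 := by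
  induction m using Nat.strong_induction_on with
  | _ m ih =>
    rcases Nat.eq_zero_or_pos m with rfl | hm
    · exact ⟨0, fun _ => false, by simp, by simp⟩
    · obtain ⟨m', b, rfl⟩ : ∃ m' : ℕ, ∃ b : Bool, m = 2 * m' + (if b then 2 else 1) := by
        rcases Nat.even_or_odd' m with ⟨c, rfl | rfl⟩
        · exact ⟨c - 1, true, by simp; omega⟩
        · exact ⟨c, false, by simp⟩
      obtain ⟨n, δ, h1, h2⟩ := ih m' (by split_ifs <;> omega)
      refine ⟨n + 1, fun l => Nat.casesOn l b δ, ?_, ?_⟩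
      · rw [sum_range_succ', ← h1, mul_sum]
        simp only [pow_zero, mul_one]
        congr 1
        refine sum_congr rfl fun l _ => ?_
        ring
      · rw [pow_succ]
        split_ifs <;> omega

namespace Presentation

variable {ι : Type} (n : ι → ℕ) (δ : ι → ℕ → Bool)

/-- The generators: the multiples `2 ^ j`, partial sums and auxiliary sums, for each cyclic
factor. -/
abbrev Gen : Type := Σ i : ι, (Fin (n i + 1) × Fin 3) ⊕ Unit

/-- The relations. -/
abbrev Rel : Type := Σ i : ι, (Fin (n i) × Fin 3) ⊕ Fin 2

variable {n}

/-- The generator standing for the multiple `2 ^ j`. -/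
def power (i : ι) (j : Fin (n i + 1)) : Gen n := ⟨i, Sum.inl (j, 0)⟩

/-- The generator standing for the sum of the first `j` terms of the expansion. -/
def partialSum (i : ι) (j : Fin (n i + 1)) : Gen n := ⟨i, Sum.inl (j, 1)⟩

/-- The auxiliary generators. -/
def auxiliary (i : ι) (j : Fin (n i + 1)) : Gen n := ⟨i, Sum.inl (j, 2)⟩

/-- The generator used to identify the first and the last partial sum. -/
def closing (i : ι) : Gen n := ⟨i, Sum.inr ()⟩

variable (n) in
/-- The terms of the relations. -/
def term : Rel n → Fin 3 → Gen n
  | ⟨i, Sum.inl (j, 0)⟩ => ![partialSum i j.castSucc,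
      if δ i j then auxiliary i j.castSucc else partialSum i j.succ, power i j.castSucc]
  | ⟨i, Sum.inl (j, 1)⟩ => ![if δ i j then auxiliary i j.castSucc else partialSum i j.succ,
      if δ i j then partialSum i j.succ else auxiliary i j.castSucc, power i j.castSucc]
  | ⟨i, Sum.inl (j, 2)⟩ => ![partialSum i j.castSucc,
      if δ i j then partialSum i j.succ else auxiliary i j.castSucc, power i j.succ]
  | ⟨i, Sum.inr 0⟩ => ![partialSum i 0, auxiliary i (Fin.last _), closing i]
  | ⟨i, Sum.inr 1⟩ => ![partialSum i (Fin.last _), auxiliary i (Fin.last _), closing i]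

theorem injective_of_three {α : Type*} {a b c : α} (h1 : a ≠ b) (h2 : a ≠ c) (h3 : b ≠ c) :
    Function.Injective ![a, b, c] := by
  intro i j h
  fin_cases i <;> fin_cases j <;> simp_all [eq_comm]

/-- The relation `power (j+1) = power j + power j` would repeat a term. Instead `power j` is added
twice to a partial sum, and the result is compared with one addition of `power (j+1)`. Of the two
sums obtained, one is the next partial sum and the other is auxiliary. With a digit `0` the next
partial sum would be neither, hence the digits `1` and `2`. -/
theorem term_injective (r : Rel n) : Function.Injective (term n δ r) := by
  rcases r with ⟨i, ⟨j, c⟩ | c⟩ <;> fin_cases c <;> refine injective_of_three ?_ ?_ ?_ <;>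
    (try split_ifs) <;>
    simp [power, partialSum, auxiliary, closing, Fin.ext_iff]

theorem term_fst (r : Rel n) (a : Fin 3) : (term n δ r a).1 = r.1 := by
  rcases r with ⟨i, ⟨j, c⟩ | c⟩ <;> fin_cases c <;> fin_cases a <;> simp [term] <;>
    (try split_ifs) <;> rfl

theorem term_inl (i : ι) (j : Fin (n i)) (c a : Fin 3) : ∃ j' κ,
    term n δ ⟨i, Sum.inl (j, c)⟩ a = ⟨i, Sum.inl (j', κ)⟩ ∧ ((j' : ℕ) = j ∨ (j' : ℕ) = j + 1) := by
  fin_cases c <;> fin_cases a <;> cases h : δ i j <;>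
    simp [term, h, power, partialSum, auxiliary]

section Values

variable {A B : Type*} [AddCommGroup A] [AddCommGroup B]

/-- The sum of the first `j` terms of the expansion. -/
def expansion (δ : ι → ℕ → Bool) (i : ι) (j : ℕ) : ℕ :=
  ∑ l ∈ range j, (if δ i l then 2 else 1) * 2 ^ l

/-- The values of the generators determined by those of `power i 0`, `partialSum i 0` and
`closing i`. -/
def value (u v w : ι → A) : Gen n → A
  | ⟨i, Sum.inl (j, 0)⟩ => 2 ^ (j : ℕ) • u i
  | ⟨i, Sum.inl (j, 1)⟩ => v i + expansion δ i j • u i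
  | ⟨i, Sum.inl (j, 2)⟩ => if (j : ℕ) < n i then
      v i + (expansion δ i j + (if δ i j then 1 else 2) * 2 ^ (j : ℕ)) • u i else v i + w i
  | ⟨i, Sum.inr _⟩ => w i

theorem map_value (f : A →+ B) (u v w : ι → A) (g : Gen n) :
    f (value δ u v w g) =
      value δ (fun i => f (u i)) (fun i => f (v i)) (fun i => f (w i)) g := by
  rcases g with ⟨i, ⟨j, c⟩ | c⟩
  · fin_cases c <;> simp only [value] <;> (try split_ifs) <;> simp
  · rfl

theorem value_term (u v w : ι → A) (hu : ∀ i, expansion δ i (n i) • u i = 0) (r : Rel n) :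
    value δ u v w (term n δ r 0) - value δ u v w (term n δ r 1) +
      value δ u v w (term n δ r 2) = 0 := by
  rcases r with ⟨i, ⟨j, c⟩ | c⟩ <;> fin_cases c
  · cases h : δ i j <;>
      simp [term, h, value, power, partialSum, auxiliary, expansion, sum_range_succ] <;> module
  · cases h : δ i j <;>
      simp [term, h, value, power, partialSum, auxiliary, expansion, sum_range_succ] <;> module
  · cases h : δ i j <;>
      simp [term, h, value, power, partialSum, auxiliary, expansion, sum_range_succ, pow_succ] <;>
      module
  · simp [term, value, partialSum, auxiliary, closing, expansion]
  · simp [term, value, partialSum, auxiliary, closing, hu]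

variable {δ}

theorem map_succ_of_relations {f : Gen n → A}
    (hf : ∀ r, f (term n δ r 0) - f (term n δ r 1) + f (term n δ r 2) = 0) (i : ι)
    (j : Fin (n i)) :
    f (power i j.succ) = 2 • f (power i j.castSucc) ∧
    f (auxiliary i j.castSucc) =
      f (partialSum i j.castSucc) + (if δ i j then 1 else 2) • f (power i j.castSucc) ∧
    f (partialSum i j.succ) =
      f (partialSum i j.castSucc) + (if δ i j then 2 else 1) • f (power i j.castSucc) := by
  have h0 := hf ⟨i, Sum.inl (j, 0)⟩
  have h1 := hf ⟨i, Sum.inl (j, 1)⟩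
  have h2 := hf ⟨i, Sum.inl (j, 2)⟩
  cases h : δ i j <;> simp [term, h] at h0 h1 h2 ⊢
  · refine ⟨?_, ?_, ?_⟩
    · linear_combination (norm := module) h2 - h1 - h0
    · linear_combination (norm := module) - h1 - h0
    · linear_combination (norm := module) - h0
  · refine ⟨?_, ?_, ?_⟩
    · linear_combination (norm := module) h2 - h1 - h0
    · linear_combination (norm := module) - h0
    · linear_combination (norm := module) - h1 - h0

/-- Induction along the expansion determines everything from three values per cyclic factor; the
only remaining constraint comes from closing the chain of partial sums. -/
theorem eq_value_of_relations {f : Gen n → A}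
    (hf : ∀ r, f (term n δ r 0) - f (term n δ r 1) + f (term n δ r 2) = 0) :
    f = value δ (fun i => f (power i 0)) (fun i => f (partialSum i 0)) (fun i => f (closing i)) ∧
      ∀ i, expansion δ i (n i) • f (power i 0) = 0 := by
  have main : ∀ i (j : ℕ) (hj : j < n i + 1),
      f (power i ⟨j, hj⟩) = 2 ^ j • f (power i 0) ∧
      f (partialSum i ⟨j, hj⟩) = f (partialSum i 0) + expansion δ i j • f (power i 0) := by
    intro i j
    induction j with
    | zero =>
      intro hj
      simp [expansion]
    | succ j ih =>
      intro hj
      obtain ⟨h1, h2⟩ := ih (by omega)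
      obtain ⟨h3, -, h4⟩ := map_succ_of_relations hf i ⟨j, by omega⟩
      simp only [Fin.succ_mk, Fin.castSucc_mk] at h3 h4
      refine ⟨?_, ?_⟩
      · rw [h3, h1, smul_smul, pow_succ']
      · rw [h4, h1, h2, smul_smul, add_assoc, ← add_smul, expansion, expansion, sum_range_succ]
  have hw : ∀ i, f (auxiliary i (Fin.last _)) = f (partialSum i 0) + f (closing i) := by
    intro i
    have h := hf ⟨i, Sum.inr 0⟩
    simp [term] at h
    linear_combination (norm := module) - h
  refine ⟨?_, fun i => ?_⟩
  · funext g
    rcases g with ⟨i, ⟨j, c⟩ | c⟩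
    · fin_cases c
      · exact (main i j j.2).1
      · exact (main i j j.2).2
      · change f (auxiliary i j) = ite _ _ _
        by_cases hj : (j : ℕ) < n i
        · rw [if_pos hj]
          obtain ⟨-, h, -⟩ := map_succ_of_relations hf i ⟨j, hj⟩
          have e : (⟨j, hj⟩ : Fin (n i)).castSucc = j := rfl
          rw [e] at h
          rw [h, (main i j j.2).1, (main i j j.2).2, smul_smul, add_assoc, ← add_smul]
        · rw [if_neg hj]
          have : j = Fin.last _ := Fin.ext (by simp; omega)
          rw [this, hw]
    · rfl
  -- The two closing relations share two terms, so they identify the first and the last partial sum.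
  · have h := hf ⟨i, Sum.inr 1⟩
    have h1 := (main i (n i) (Nat.lt_succ_self _)).2
    have h2 := hw i
    change f (partialSum i (Fin.last _)) = _ at h1
    simp [term] at h
    linear_combination (norm := module) h + h2 - h1

end Values

/-- A generator of index `J` occurs only in relations of index `J` or `J - 1`. One bit, the type of
the relation and the position therefore determine an occurrence, which gives `2 * 3 * 3`; the
closing relations add `2 * 3`. -/
theorem card_term_eq_le [Fintype ι] [DecidableEq ι] (δ : ι → ℕ → Bool) (g : Gen n) :
    #{p : Rel n × Fin 3 | term n δ p.1 p.2 = g} ≤ 24 := by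
  obtain ⟨i, g⟩ := g
  -- The value `0` at a closing generator is immaterial, since `term_inl` excludes it from the
  -- indexed relations.
  set J : ℕ := Sum.elim (fun p => (p.1 : ℕ)) (fun _ => 0) g with hJ
  have hcard : #(univ : Finset ((Bool × Fin 3 × Fin 3) ⊕ Fin 2 × Fin 3)) = 24 := by
    simp
  rw [← hcard]
  refine card_le_card_of_injOn (fun p => Sum.elim
    (fun q => Sum.inl (decide ((q.1 : ℕ) = J), q.2, p.2)) (fun c => Sum.inr (c, p.2)) p.1.2)
    (fun _ _ => mem_univ _) ?_
  rintro ⟨⟨i₁, r₁⟩, a₁⟩ h₁ ⟨⟨i₂, r₂⟩, a₂⟩ h₂ h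
  rw [mem_coe, mem_filter] at h₁ h₂
  replace h₁ := h₁.2
  replace h₂ := h₂.2
  have e₁ := (term_fst δ _ _).symm.trans (congrArg Sigma.fst h₁)
  have e₂ := (term_fst δ _ _).symm.trans (congrArg Sigma.fst h₂)
  simp only at e₁ e₂
  subst e₁
  subst e₂
  rcases r₁ with ⟨j₁, c₁⟩ | c₁ <;> rcases r₂ with ⟨j₂, c₂⟩ | c₂ <;>
    simp only [Sum.elim_inl, Sum.elim_inr, Sum.inl.injEq, Sum.inr.injEq, Prod.mk.injEq,
      decide_eq_decide, reduceCtorEq] at h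
  · obtain ⟨j₁', κ₁, h₁', hj₁⟩ := term_inl δ i₂ j₁ c₁ a₁
    obtain ⟨j₂', κ₂, h₂', hj₂⟩ := term_inl δ i₂ j₂ c₂ a₂
    rw [h₁'] at h₁
    rw [h₂'] at h₂
    have g₁ : g = Sum.inl (j₁', κ₁) := (eq_of_heq (Sigma.mk.inj h₁).2).symm
    have g₂ : g = Sum.inl (j₂', κ₂) := (eq_of_heq (Sigma.mk.inj h₂).2).symm
    have hJ₁ : J = j₁' := by rw [hJ, g₁]; rfl
    have hJ₂ : J = j₂' := by rw [hJ, g₂]; rfl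
    obtain ⟨hj, rfl, rfl⟩ := h
    have : j₁ = j₂ := by ext; omega
    rw [this]
  · rw [h.1, h.2]

/-- The group presented by the generators and relations. -/
abbrev Target (m : ι → ℕ) : Type := (⨁ i, ZMod (m i)) × (ι × Bool →₀ ℤ)

/-- The free summand carries the unconstrained first partial sums and closing generators, and
contributes no torsion. -/
theorem nonempty_torsion_target_addEquiv [Fintype ι] {m : ι → ℕ} (hm : ∀ i, 1 < m i) :
    Nonempty (AddCommGroup.torsion (Target m) ≃+ ⨁ i, ZMod (m i)) := by
  have : ∀ i, NeZero (m i) := fun i => ⟨by have := hm i; omega⟩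
  have hfin : Finite (⨁ i, ZMod (m i)) :=
    Finite.of_equiv _ (DirectSum.addEquivProd fun i => ZMod (m i)).symm.toEquiv
  refine ⟨AddEquiv.ofBijective
    ((AddMonoidHom.fst _ _).comp (AddCommGroup.torsion (Target m)).subtype) ⟨?_, ?_⟩⟩
  · rw [injective_iff_map_eq_zero]
    rintro ⟨⟨a, b⟩, h⟩ h0
    obtain ⟨l, hl, hl0⟩ := isOfFinAddOrder_iff_nsmul_eq_zero.mp h
    have hb : b = 0 := (smul_eq_zero.mp (congrArg Prod.snd hl0)).resolve_left hl.ne'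
    have ha : a = 0 := h0
    subst ha hb
    rfl
  · intro a
    refine ⟨⟨(a, 0), ?_⟩, rfl⟩
    obtain ⟨l, hl, hl0⟩ := isOfFinAddOrder_iff_nsmul_eq_zero.mp (isOfFinAddOrder_of_finite a)
    exact isOfFinAddOrder_iff_nsmul_eq_zero.mpr ⟨l, hl, by simp [hl0]⟩

variable [DecidableEq ι]

/-- The values of the generators. -/
def evaluate (m : ι → ℕ) : (Gen n →₀ ℤ) →ₗ[ℤ] Target m :=
  Finsupp.linearCombination ℤ (value δ (fun i => (DirectSum.of (fun i => ZMod (m i)) i 1, 0))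
    (fun i => (0, Finsupp.single (i, false) 1)) fun i => (0, Finsupp.single (i, true) 1))

theorem evaluate_surjective (m : ι → ℕ) : Function.Surjective (evaluate (n := n) δ m) := by
  rw [← LinearMap.range_eq_top]
  set P := LinearMap.range (evaluate (n := n) δ m) with hP
  have h1 : ∀ i, ((DirectSum.of (fun i => ZMod (m i)) i 1, 0) : Target m) ∈ P := fun i =>
    ⟨Finsupp.single (power i 0) 1, by simp [evaluate, power, value]⟩
  have h2 : ∀ i b, ((0, Finsupp.single (i, b) 1) : Target m) ∈ P := by
    rintro i (_ | _)
    · exact ⟨Finsupp.single (partialSum i 0) 1, by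
        simp [evaluate, partialSum, value, expansion]⟩
    · exact ⟨Finsupp.single (closing i) 1, by simp [evaluate, closing, value]⟩
  rw [eq_top_iff]
  rintro ⟨a, b⟩ -
  have ha : ((a, 0) : Target m) ∈ P := by
    induction a using DirectSum.induction_on with
    | zero => exact zero_mem _
    | of i z =>
      obtain ⟨z, rfl⟩ := ZMod.intCast_surjective z
      have := P.smul_mem z (h1 i)
      rwa [Prod.smul_mk, smul_zero, ← map_zsmul, zsmul_one] at this
    | add a b ha hb => simpa using add_mem ha hb
  have hb : ((0, b) : Target m) ∈ P := by
    induction b using Finsupp.induction_linear with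
    | zero => exact zero_mem _
    | single p z => simpa using P.smul_mem z (h2 p.1 p.2)
    | add a b ha hb => simpa using add_mem ha hb
  simpa using add_mem ha hb

variable {δ} in
theorem ker_evaluate {m : ι → ℕ} (hm : ∀ i, expansion δ i (n i) = m i) :
    LinearMap.ker (evaluate (n := n) δ m) =
      Submodule.span ℤ (Set.range (Gadget.ternaryRelation (term n δ))) := by
  refine le_antisymm ?_ (Submodule.span_le.mpr ?_)
  · set P := Submodule.span ℤ (Set.range (Gadget.ternaryRelation (term n δ))) with hP
    set f : Gen n → (Gen n →₀ ℤ) ⧸ P := fun g => P.mkQ (Finsupp.single g 1) with hf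
    have hrel : ∀ r, f (term n δ r 0) - f (term n δ r 1) + f (term n δ r 2) = 0 := by
      intro r
      simp only [hf, ← map_sub, ← map_add]
      exact (Submodule.Quotient.mk_eq_zero P).mpr (Submodule.subset_span ⟨r, rfl⟩)
    obtain ⟨hval, htor⟩ := eq_value_of_relations hrel
    have hz : ∀ i, zmultiplesHom _ (f (power i 0)) (m i : ℤ) = 0 := fun i => by
      have := htor i
      rw [hm] at this
      simpa using this
    -- The presented group satisfies `m i • power i 0 = 0`, so `Target m` maps to it. Composed with
    -- evaluation this is the quotient map, so whatever evaluates to zero lies in the span of the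
    -- relations.
    set Ψ : Target m →+ (Gen n →₀ ℤ) ⧸ P :=
      (DirectSum.toAddMonoid fun i => ZMod.lift (m i) ⟨zmultiplesHom _ (f (power i 0)), hz i⟩).coprod
        (Finsupp.linearCombination ℤ fun p : ι × Bool =>
          if p.2 then f (closing p.1) else f (partialSum p.1 0)).toAddMonoidHom with hΨ
    have hcomp : Ψ.toIntLinearMap ∘ₗ evaluate δ m = P.mkQ := by
      refine Finsupp.lhom_ext' fun g => LinearMap.ext_ring ?_
      change Ψ (Finsupp.linearCombination ℤ _ (Finsupp.single g 1)) = f g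
      rw [Finsupp.linearCombination_single, one_smul, map_value]
      conv_rhs => rw [hval]
      congr 1 <;> funext i
      · have : ZMod.lift (m i) ⟨zmultiplesHom _ (f (power i 0)), hz i⟩ ((1 : ℤ) : ZMod (m i)) =
            f (power i 0) := by
          rw [ZMod.lift_coe]; simp
        simpa [hΨ] using this
      · simp [hΨ]
      · simp [hΨ]
    intro e he
    rw [LinearMap.mem_ker] at he
    have := LinearMap.congr_fun hcomp e
    rw [LinearMap.comp_apply, he, map_zero] at this
    exact (Submodule.Quotient.mk_eq_zero P).mp this.symm
  · rintro _ ⟨r, rfl⟩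
    rw [SetLike.mem_coe, LinearMap.mem_ker, Gadget.ternaryRelation, map_add, map_sub]
    simp only [evaluate, Finsupp.linearCombination_single, one_smul]
    refine value_term δ _ _ _ (fun i => ?_) r
    rw [hm, Prod.smul_mk, ← map_nsmul]
    simp

end Presentation

/-- Every finite abelian group is the torsion of a group with a presentation of logarithmic size
in which every generator is used boundedly often. -/
theorem exists_presentation (G : Type*) [AddCommGroup G] [Finite G] :
    ∃ (N R M : Type) (_ : Fintype N) (_ : Fintype R) (_ : DecidableEq N) (_ : DecidableEq R)
      (_ : AddCommGroup M) (x : R → Fin 3 → N) (Λ : (N →₀ ℤ) →ₗ[ℤ] M),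
      (∀ r, Function.Injective (x r)) ∧ (∀ n, #{p : R × Fin 3 | x p.1 p.2 = n} ≤ 24) ∧
      Function.Surjective Λ ∧
      LinearMap.ker Λ = Submodule.span ℤ (Set.range (Gadget.ternaryRelation x)) ∧
      Nonempty (AddCommGroup.torsion M ≃+ G) ∧
      (Fintype.card N + Fintype.card R : ℝ) ≤ 36 * Real.log (Nat.card G) := by
  classical
  obtain ⟨ι, _, m, hm, ⟨e⟩⟩ := AddCommGroup.equiv_directSum_zmod_of_finite' G
  choose n δ hexp hpow using fun i => exists_bijective_binary (m i)
  obtain ⟨e'⟩ := Presentation.nonempty_torsion_target_addEquiv hm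
  refine ⟨Presentation.Gen n, Presentation.Rel n, Presentation.Target m, inferInstance,
    inferInstance, inferInstance, inferInstance, inferInstance, Presentation.term n δ,
    Presentation.evaluate δ m, Presentation.term_injective δ, Presentation.card_term_eq_le δ,
    Presentation.evaluate_surjective δ m, Presentation.ker_evaluate hexp,
    ⟨e'.trans e.symm⟩, ?_⟩
  have hcard : Nat.card G = ∏ i, m i := by
    have : ∀ i, NeZero (m i) := fun i => ⟨by have := hm i; omega⟩
    rw [Nat.card_congr (e.trans (DirectSum.addEquivProd fun i => ZMod (m i))).toEquiv,
      Nat.card_pi]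
    simp
  rw [hcard, Nat.cast_prod, Real.log_prod (fun i _ => by
    have := hm i
    exact_mod_cast (by omega : m i ≠ 0)), mul_sum]
  have hN : Fintype.card (Presentation.Gen n) + Fintype.card (Presentation.Rel n) =
      ∑ i, (6 * n i + 6) := by
    rw [Fintype.card_sigma, Fintype.card_sigma, ← sum_add_distrib]
    refine sum_congr rfl fun i _ => ?_
    simp
    ring
  rw [← Nat.cast_add, hN, Nat.cast_sum]
  refine sum_le_sum fun i _ => ?_
  have hmi := hm i
  have hn1 : 1 ≤ n i := by
    by_contra! h
    have h0 : n i = 0 := by omega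
    have := hexp i
    rw [h0] at this
    simp at this
    omega
  -- From `2 ^ n ≤ m + 1 ≤ m ^ 2` one gets `6 n + 6 ≤ 12 n ≤ 24 log m / log 2 ≤ 36 log m`.
  have hlog : (n i : ℝ) * Real.log 2 ≤ 2 * Real.log (m i) := by
    have h1 : (2 : ℝ) ^ n i ≤ (m i : ℝ) ^ 2 := by
      have : 2 ^ n i ≤ m i ^ 2 := (hpow i).trans (by nlinarith)
      exact_mod_cast this
    have h2 := Real.log_le_log (by positivity) h1
    rw [Real.log_pow, Real.log_pow] at h2
    exact_mod_cast h2
  have hl2 := Real.log_two_gt_d9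
  have hn1' : (1 : ℝ) ≤ n i := by exact_mod_cast hn1
  push_cast
  nlinarith

end

/-! ### Lower bound: counting torsion classes by short chains. -/

noncomputable section

open Finset

/-- The number of integer vectors with bounded `ℓ¹` norm. -/
theorem exists_finset_of_sum_abs_le (κ : Type*) [Fintype κ] (r : ℕ) :
    ∃ F : Finset (κ →₀ ℤ), #F ≤ 2 ^ r * 4 ^ Fintype.card κ ∧
      ∀ c : κ →₀ ℤ, ∑ x, |c x| ≤ r → c ∈ F := by
  classical
  set P : Finset (κ → ℤ) := {f ∈ Fintype.piFinset fun _ => Icc (-(r : ℤ)) r | ∑ x, |f x| ≤ r}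
    with hP
  -- Weight a vector `f` by `2 ^ (-‖f‖₁)`. The total weight factors over the coordinates, each
  -- factor being at most two geometric series of sum at most `2`, while each vector counted has
  -- weight at least `2 ^ (-r)`.
  have h1 : ∑ z ∈ Icc (-(r : ℤ)) r, (1 / 2 : ℝ) ^ z.natAbs ≤ 4 := by
    have hsub : Icc (-(r : ℤ)) r ⊆ (range (r + 1)).image (fun i : ℕ => (i : ℤ)) ∪
        (range (r + 1)).image (fun i : ℕ => -(i : ℤ)) := by
      intro z hz
      rw [mem_Icc] at hz
      simp only [mem_union, mem_image, mem_range]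
      rcases le_total 0 z with h | h
      · exact Or.inl ⟨z.natAbs, by omega, by omega⟩
      · exact Or.inr ⟨z.natAbs, by omega, by omega⟩
    have hnn : ∀ z : ℤ, 0 ≤ (1 / 2 : ℝ) ^ z.natAbs := fun z => by positivity
    refine (sum_le_sum_of_subset_of_nonneg hsub fun z _ _ => hnn z).trans ?_
    have h := sum_union_inter (s₁ := (range (r + 1)).image (fun i : ℕ => (i : ℤ)))
      (s₂ := (range (r + 1)).image (fun i : ℕ => -(i : ℤ)))
      (f := fun z : ℤ => (1 / 2 : ℝ) ^ z.natAbs)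
    rw [sum_image (fun a _ b _ h => by simpa using h),
      sum_image (fun a _ b _ h => by simpa using h)] at h
    simp only [Int.natAbs_neg, Int.natAbs_natCast] at h
    have h2 := sum_geometric_two_le (r + 1)
    have h3 := sum_nonneg (s := (range (r + 1)).image (fun i : ℕ => (i : ℤ)) ∩
      (range (r + 1)).image (fun i : ℕ => -(i : ℤ))) fun z _ => hnn z
    linarith
  have h2 : (#P : ℝ) * (1 / 2) ^ r ≤ 4 ^ Fintype.card κ := by
    calc (#P : ℝ) * (1 / 2) ^ r = ∑ f ∈ P, (1 / 2 : ℝ) ^ r := by rw [sum_const, nsmul_eq_mul]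
      _ ≤ ∑ f ∈ P, ∏ x, (1 / 2 : ℝ) ^ (f x).natAbs := by
          refine sum_le_sum fun f hf => ?_
          rw [prod_pow_eq_pow_sum]
          refine pow_le_pow_of_le_one (by norm_num) (by norm_num) ?_
          have := (mem_filter.mp hf).2
          have e : ((∑ x, (f x).natAbs : ℕ) : ℤ) = ∑ x, |f x| := by
            push_cast; rfl
          omega
      _ ≤ ∑ f ∈ Fintype.piFinset fun _ : κ => Icc (-(r : ℤ)) r,
            ∏ x, (1 / 2 : ℝ) ^ (f x).natAbs :=
          sum_le_sum_of_subset_of_nonneg (filter_subset _ _) fun f _ _ =>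
            prod_nonneg fun x _ => by positivity
      _ = ∏ x : κ, ∑ z ∈ Icc (-(r : ℤ)) r, (1 / 2 : ℝ) ^ z.natAbs :=
          (prod_univ_sum (fun _ => Icc (-(r : ℤ)) r) fun _ z => (1 / 2 : ℝ) ^ z.natAbs).symm
      _ ≤ ∏ x : κ, (4 : ℝ) := prod_le_prod (fun x _ => sum_nonneg fun z _ => by positivity)
          fun x _ => h1
      _ = 4 ^ Fintype.card κ := by rw [prod_const, card_univ]
  refine ⟨P.image Finsupp.equivFunOnFinite.symm, card_image_le.trans ?_, fun c hc => ?_⟩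
  · have h3 : (#P : ℝ) ≤ 2 ^ r * 4 ^ Fintype.card κ := by
      rw [one_div, inv_pow, ← div_eq_mul_inv, div_le_iff₀ (by positivity)] at h2
      linarith
    exact_mod_cast h3
  · refine mem_image.mpr ⟨c, ?_, by ext; simp⟩
    refine mem_filter.mpr ⟨Fintype.mem_piFinset.mpr fun x => ?_, hc⟩
    rw [mem_Icc, ← abs_le]
    exact (single_le_sum (fun y _ => abs_nonneg (c y)) (mem_univ x)).trans hc

/-- The torsion of the quotient of a free abelian group by a subgroup generated by vectors of
small `ℓ¹` norm has representatives with small `ℓ¹` norm. -/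
theorem exists_sub_mem_span_of_smul_mem {κ J : Type*} [Fintype κ] (b : J → κ →₀ ℤ) {L : ℕ}
    (hb : ∀ j, ∑ x, |b j x| ≤ L) {c : κ →₀ ℤ} {N : ℕ} (hN : 0 < N)
    (hc : N • c ∈ Submodule.span ℤ (Set.range b)) :
    ∃ c' : κ →₀ ℤ, ∑ x, |c' x| ≤ (L * Fintype.card κ : ℕ) ∧
      c - c' ∈ Submodule.span ℤ (Set.range b) := by
  classical
  set φ : (κ →₀ ℤ) →+ (κ → ℚ) :=
    { toFun := fun f x => (f x : ℚ)
      map_zero' := by ext; simp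
      map_add' := fun f g => by ext; simp } with hφ
  obtain ⟨I, a, -, hspan, hli⟩ := exists_linearIndependent' ℚ fun j => φ (b j)
  have : Finite I := hli.finite
  have := Fintype.ofFinite I
  have hI : Fintype.card I ≤ Fintype.card κ := by
    simpa using hli.fintype_card_le_finrank
  have hφc : φ c ∈ Submodule.span ℚ (Set.range ((fun j => φ (b j)) ∘ a)) := by
    rw [hspan]
    have h1 : φ (N • c) ∈ Submodule.span ℚ (Set.range fun j => φ (b j)) := by
      have h2 : Submodule.span ℤ (Set.range b) ≤
          ((Submodule.span ℚ (Set.range fun j => φ (b j))).restrictScalars ℤ).comap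
            φ.toIntLinearMap := by
        rw [Submodule.span_le]
        rintro _ ⟨j, rfl⟩
        exact Submodule.subset_span ⟨j, rfl⟩
      exact h2 hc
    have h3 := Submodule.smul_mem _ (N : ℚ)⁻¹ h1
    rwa [map_nsmul, ← Nat.cast_smul_eq_nsmul ℚ, smul_smul, inv_mul_cancel₀ (by positivity),
      one_smul] at h3
  obtain ⟨t, ht⟩ := (Submodule.mem_span_range_iff_exists_fun ℚ).mp hφc
  -- Subtracting integer parts leaves coefficients in `[0, 1)` on a rationally independent family,
  -- which has at most `Fintype.card κ` members, each of norm at most `L`.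
  refine ⟨c - ∑ i, ⌊t i⌋ • b (a i), ?_, ?_⟩
  · have hx : ∀ x, ((c - ∑ i, ⌊t i⌋ • b (a i)) x : ℚ) = ∑ i, Int.fract (t i) * b (a i) x := by
      intro x
      have h1 := congrFun ht x
      simp only [Finset.sum_apply, Pi.smul_apply, Function.comp_apply, smul_eq_mul] at h1
      have h2 : φ c x = c x := rfl
      have h3 : ∀ i, φ (b (a i)) x = b (a i) x := fun _ => rfl
      simp only [h2, h3] at h1
      rw [Finsupp.sub_apply, Finsupp.finsetSum_apply, Int.cast_sub, ← h1, Int.cast_sum,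
        ← sum_sub_distrib]
      refine sum_congr rfl fun i _ => ?_
      rw [Finsupp.smul_apply, smul_eq_mul, Int.cast_mul, Int.fract]
      ring
    have hbound : ((∑ x, |(c - ∑ i, ⌊t i⌋ • b (a i)) x| : ℤ) : ℚ) ≤
        ((L * Fintype.card κ : ℕ) : ℤ) := by
      simp only [Int.cast_sum, Int.cast_abs]
      calc ∑ x, |((c - ∑ i, ⌊t i⌋ • b (a i)) x : ℚ)|
          = ∑ x, |∑ i, Int.fract (t i) * b (a i) x| := sum_congr rfl fun x _ => by rw [hx]
        _ ≤ ∑ x, ∑ i, |(b (a i) x : ℚ)| := by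
            refine sum_le_sum fun x _ => (abs_sum_le_sum_abs _ _).trans
              (sum_le_sum fun i _ => ?_)
            rw [abs_mul, abs_of_nonneg (Int.fract_nonneg _)]
            exact mul_le_of_le_one_left (abs_nonneg _) (Int.fract_lt_one _).le
        _ = ∑ i, ∑ x, |(b (a i) x : ℚ)| := sum_comm
        _ ≤ ∑ i : I, (L : ℚ) := sum_le_sum fun i _ => by exact_mod_cast hb (a i)
        _ = Fintype.card I * L := by rw [sum_const, card_univ, nsmul_eq_mul]
        _ ≤ ((L * Fintype.card κ : ℕ) : ℤ) := by
            push_cast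
            rw [mul_comm]
            gcongr
    exact_mod_cast hbound
  · rw [sub_sub_cancel]
    exact sum_mem fun i _ => Submodule.smul_mem _ _ (Submodule.subset_span ⟨a i, rfl⟩)

namespace AbstractSimplicialComplex

theorem card_simplex_le {n : ℕ} (X : AbstractSimplicialComplex (Fin n)) (k : ℕ) :
    Finite (X.Simplex k) ∧ Nat.card (X.Simplex k) ≤ n ^ (k + 1) := by
  have hinj : Function.Injective fun s : X.Simplex k =>
      (⟨s.1, mem_powersetCard.mpr ⟨subset_univ _, s.2.2⟩⟩ :
        {s // s ∈ powersetCard (k + 1) (univ : Finset (Fin n))}) :=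
    fun s t h => Subtype.ext (congrArg (fun p => p.1) h)
  refine ⟨Finite.of_injective _ hinj, (Nat.card_le_card_of_injective _ hinj).trans ?_⟩
  rw [Nat.card_eq_fintype_card, Fintype.card_coe, card_powersetCard, card_univ, Fintype.card_fin]
  exact Nat.choose_le_pow _ _

/-- The boundary of a simplex has `ℓ¹` norm `k + 3`, so each torsion class differs from a short
chain by a boundary. Classes sharing a short chain coincide, so the short chains need not be shown
to be cycles. -/
theorem card_torsion_homology_le {n : ℕ} (X : AbstractSimplicialComplex (Fin n)) (k : ℕ) :
    Nat.card (AddCommGroup.torsion (X.Homology (k + 1))) ≤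
      (2 ^ (k + 3) * 4) ^ n ^ (k + 2) := by
  classical
  obtain ⟨hfin, hcard⟩ := X.card_simplex_le (k + 1)
  have := Fintype.ofFinite (X.Simplex (k + 1))
  set b : X.Simplex (k + 2) → X.Chain (k + 1) := fun s =>
    ∑ v : {v // v ∈ s.1}, Finsupp.single (s.facet v) (vertexSign s.1 v.1) with hb
  have hrange : LinearMap.range (X.boundary (k + 1)) = Submodule.span ℤ (Set.range b) :=
    Finsupp.range_linearCombination ℤ
  have hnorm : ∀ s, ∑ x, |b s x| ≤ (k + 3 : ℕ) := by
    intro s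
    calc ∑ x, |b s x| ≤ ∑ x, ∑ v : {v // v ∈ s.1},
          |Finsupp.single (s.facet v) (vertexSign s.1 v.1) x| :=
          sum_le_sum fun x _ => by
            rw [hb, Finsupp.finsetSum_apply]
            exact abs_sum_le_sum_abs _ _
      _ = ∑ v : {v // v ∈ s.1}, ∑ x, |Finsupp.single (s.facet v) (vertexSign s.1 v.1) x| :=
          sum_comm
      _ = ∑ v : {v // v ∈ s.1}, 1 := by
          refine sum_congr rfl fun v _ => ?_
          rw [sum_eq_single (s.facet v)]
          · rw [Finsupp.single_eq_same, vertexSign, abs_pow, abs_neg, abs_one, one_pow]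
          · intro y _ hy
            rw [Finsupp.single_eq_of_ne hy, abs_zero]
          · simp
      _ = (k + 3 : ℕ) := by
          rw [sum_const, card_univ, Fintype.card_coe, s.2.2]
          push_cast
          ring
  obtain ⟨F, hF, hFc⟩ := exists_finset_of_sum_abs_le (X.Simplex (k + 1))
    ((k + 3) * Fintype.card (X.Simplex (k + 1)))
  have hrep : ∀ h : AddCommGroup.torsion (X.Homology (k + 1)), ∃ c' ∈ F,
      ∃ c : X.cycles (k + 1), Submodule.Quotient.mk c = h.1 ∧
        c.1 - c' ∈ LinearMap.range (X.boundary (k + 1)) := by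
    rintro ⟨h, hh⟩
    obtain ⟨N, hN, hN0⟩ := isOfFinAddOrder_iff_nsmul_eq_zero.mp hh
    obtain ⟨c, rfl⟩ := Submodule.mkQ_surjective _ h
    have hc : N • c.1 ∈ Submodule.span ℤ (Set.range b) := by
      rw [← hrange]
      rw [← map_nsmul] at hN0
      have h0 : N • c ∈ (LinearMap.range (X.boundary (k + 1))).submoduleOf (X.cycles (k + 1)) :=
        (Submodule.Quotient.mk_eq_zero _).mp hN0
      exact h0
    obtain ⟨c', h1, h2⟩ := exists_sub_mem_span_of_smul_mem b hnorm hN hc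
    exact ⟨c', hFc c' h1, c, rfl, by rwa [hrange]⟩
  choose r hr c hc hcr using hrep
  have hinj : Function.Injective fun h => (⟨r h, hr h⟩ : {x // x ∈ F}) := by
    intro h h' heq
    have heq' : r h = r h' := congrArg Subtype.val heq
    have := sub_mem (hcr h) (hcr h')
    rw [heq', sub_sub_sub_cancel_right] at this
    refine Subtype.ext ?_
    rw [← hc h, ← hc h', Submodule.Quotient.eq]
    exact this
  refine (Nat.card_le_card_of_injective _ hinj).trans ?_
  rw [Nat.card_eq_fintype_card, Fintype.card_coe]
  refine hF.trans ?_
  rw [pow_mul, ← mul_pow, ← Nat.card_eq_fintype_card]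
  exact Nat.pow_le_pow_right (by positivity) hcard

theorem subsingleton_homology_of_isEmpty (X : AbstractSimplicialComplex (Fin 0)) (k : ℕ) :
    Subsingleton (X.Homology k) := by
  have : IsEmpty (X.Simplex k) := ⟨fun s => by
    have h := s.2.2
    rw [Subsingleton.elim s.1 ∅, card_empty] at h
    omega⟩
  exact (Submodule.mkQ_surjective _).subsingleton

end AbstractSimplicialComplex

/-! ### Assembling the two bounds. -/

/-- Logarithmic lower bound for the number of vertices. -/
theorem log_card_le_of_mem_torsionVertexCounts {k n : ℕ} {G : Type*} [AddCommGroup G] [Finite G]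
    (hn : n ∈ torsionVertexCounts (k + 2) G) :
    Real.log (Nat.card G) ≤ (n : ℝ) ^ (k + 2) * Real.log (2 ^ (k + 3) * 4) := by
  obtain ⟨X, ⟨e⟩⟩ := hn
  have h : Nat.card G ≤ (2 ^ (k + 3) * 4) ^ n ^ (k + 2) := by
    rw [← Nat.card_congr e.toEquiv]
    exact X.card_torsion_homology_le k
  have h1 : (Nat.card G : ℝ) ≤ (2 ^ (k + 3) * 4) ^ n ^ (k + 2) := by exact_mod_cast h
  have h2 := Real.log_le_log (by exact_mod_cast Nat.card_pos) h1
  rw [Real.log_pow] at h2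
  exact_mod_cast h2

/-- Every finite abelian group occurs with few vertices. -/
theorem exists_mem_torsionVertexCounts (k : ℕ) : ∃ C : ℝ, 0 < C ∧
    ∀ (G : Type*) [AddCommGroup G] [Finite G], ∃ n ∈ torsionVertexCounts (k + 2) G,
      (n : ℝ) ≤ C * Real.log (Nat.card G) ^ (1 / ((k + 2 : ℕ) : ℝ)) := by
  obtain ⟨C₀, hC₀⟩ := Gadget.exists_complex_of_presentation k 24
  set p : ℝ := 1 / ((k + 2 : ℕ) : ℝ) with hp
  have hp0 : 0 < p := by positivity
  have hl2 : 0 < Real.log 2 := Real.log_pos (by norm_num)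
  -- The second summand absorbs the rounding of `q` to an integer, because `log |G| ≥ log 2` for
  -- nontrivial `G`.
  set a : ℝ := ((k + 4) * 36) ^ p + (1 / Real.log 2) ^ p with ha
  have ha0 : 0 < a := by positivity
  refine ⟨(C₀ + 1) * a, by positivity, fun G _ _ => ?_⟩
  -- For the trivial group the right side is `0`, which forces the empty complex.
  rcases Nat.eq_or_lt_of_le (Nat.one_le_iff_ne_zero.mpr (Nat.card_pos (α := G)).ne') with h1 | h1
  · refine ⟨0, ⟨⊤, ?_⟩, ?_⟩
    · have : Subsingleton G := (Nat.card_eq_one_iff_unique.mp h1.symm).1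
      have := AbstractSimplicialComplex.subsingleton_homology_of_isEmpty ⊤ (k + 2 - 1)
      exact ⟨{ toFun := 0, invFun := 0, left_inv := fun _ => Subsingleton.elim _ _,
               right_inv := fun _ => Subsingleton.elim _ _, map_add' := fun _ _ => by simp }⟩
    · rw [← h1, Nat.cast_one, Real.log_one, Real.zero_rpow hp0.ne']
      simp
  · obtain ⟨N, R, M, _, _, _, _, _, x, Λ, hx, hB, hΛ, hker, ⟨e⟩, hcard⟩ := exists_presentation G
    set l := Real.log (Nat.card G) with hl
    have hl2' : Real.log 2 ≤ l := Real.log_le_log (by norm_num) (by exact_mod_cast h1)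
    have hl0 : 0 < l := hl2.trans_le hl2'
    set Y : ℝ := (k + 4) * 36 * l with hY
    have hY0 : 0 < Y := by positivity
    set q := ⌈Y ^ p⌉₊ with hq
    have hq1 : 1 ≤ q := Nat.one_le_iff_ne_zero.mpr (Nat.ceil_pos.mpr (by positivity)).ne'
    have hYq : Y ≤ (q : ℝ) ^ (k + 2) := by
      have h2 : Y ^ p ≤ q := Nat.le_ceil _
      calc Y = (Y ^ p) ^ (k + 2) := by
            rw [← Real.rpow_natCast, ← Real.rpow_mul hY0.le, hp, one_div,
              inv_mul_cancel₀ (by positivity), Real.rpow_one]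
        _ ≤ _ := by gcongr
    have hsize : (k + 4) * (Fintype.card N + Fintype.card R) ≤ q ^ (k + 2) := by
      have : ((k + 4 : ℕ) : ℝ) * (Fintype.card N + Fintype.card R) ≤ (q : ℝ) ^ (k + 2) := by
        refine le_trans ?_ hYq
        push_cast
        rw [hY, mul_assoc]
        gcongr
      exact_mod_cast this
    obtain ⟨X, ⟨e'⟩⟩ := hC₀ x hx hB Λ hΛ hker q hq1 hsize
    refine ⟨C₀ * q, ⟨X, ⟨e'.trans e⟩⟩, ?_⟩
    have hq2 : (q : ℝ) ≤ a * l ^ p := by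
      have h2 : (q : ℝ) < Y ^ p + 1 := Nat.ceil_lt_add_one (by positivity)
      have h3 : (1 : ℝ) ≤ (1 / Real.log 2) ^ p * l ^ p := by
        rw [← Real.mul_rpow (by positivity) hl0.le]
        refine Real.one_le_rpow ?_ hp0.le
        rw [one_div, ← div_eq_inv_mul, one_le_div hl2]
        exact hl2'
      have h4 : Y ^ p = ((k + 4) * 36) ^ p * l ^ p := by
        rw [hY, Real.mul_rpow (by positivity) hl0.le]
      rw [ha, add_mul, ← h4]
      linarith
    have h5 : 0 ≤ a * l ^ p := by positivity
    push_cast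
    calc (C₀ : ℝ) * q ≤ C₀ * (a * l ^ p) := by gcongr
      _ ≤ (C₀ + 1) * a * l ^ p := by linarith

end

theorem theorem1 (d : ℕ) (hd : 2 ≤ d) :
    ∃ c C : ℝ, 0 < c ∧ 0 < C ∧
      ∀ (G : Type*) [AddCommGroup G] [Finite G],
        (torsionVertexCounts d G).Nonempty ∧
        c * Real.log (Nat.card G) ^ (1 / (d : ℝ)) ≤ (torsionVertexNumber d G : ℝ) ∧
        (torsionVertexNumber d G : ℝ) ≤ C * Real.log (Nat.card G) ^ (1 / (d : ℝ)) := by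
  obtain ⟨k, rfl⟩ : ∃ k, d = k + 2 := ⟨d - 2, by omega⟩
  obtain ⟨C, hC, hupper⟩ := exists_mem_torsionVertexCounts k
  have hlogB : 0 < Real.log (2 ^ (k + 3) * 4) := by
    refine Real.log_pos ?_
    have : (1 : ℝ) ≤ 2 ^ (k + 3) := one_le_pow₀ (by norm_num)
    linarith
  have hp : (0 : ℝ) < 1 / ((k + 2 : ℕ) : ℝ) := by positivity
  -- The lower constant comes from solving `log |G| ≤ n ^ d * log (2 ^ (d + 1) * 4)` for `n`.
  refine ⟨(Real.log (2 ^ (k + 3) * 4) ^ (1 / ((k + 2 : ℕ) : ℝ)))⁻¹, C, by positivity, hC,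
    fun G _ _ => ?_⟩
  obtain ⟨n, hn, hnC⟩ := hupper G
  refine ⟨⟨n, hn⟩, ?_, le_trans (Nat.cast_le.mpr (Nat.sInf_le hn)) hnC⟩
  have h := log_card_le_of_mem_torsionVertexCounts (Nat.sInf_mem ⟨n, hn⟩)
  have hlog : 0 ≤ Real.log (Nat.card G) := Real.log_natCast_nonneg _
  rw [inv_mul_le_iff₀ (by positivity)]
  refine (Real.rpow_le_rpow hlog h hp.le).trans ?_
  rw [Real.mul_rpow (by positivity) hlogB.le, ← Real.rpow_natCast, ← Real.rpow_mul (by positivity),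
    mul_one_div_cancel (by positivity), Real.rpow_one, mul_comm]
  rfl
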